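/- For $0<\varepsilon<1$ let $\eta_\varepsilon\in H^1(\mathbb R)\cap L^{2,1}(\mathbb R)$ (i.e. $\eta_\varepsilon,\eta_\varepsilon',x\eta_\varepsilon\in L^2(\mathbb R)$) be the positive solution of $$\varepsilon^2\eta_\varepsilon''(x)+(1-x^2-\eta_\varepsilon(x)^2)\,\eta_\varepsilon(x)=0,\qquad x\in\mathbb R,$$ and let $\eta_0(x)=\sqrt{1-x^2}\,\mathbf 1_{\{|x|<1\}}$. Fix $\mu>0$, put $\mathcal I_\mu=(-\tfrac1\mu,\tfrac1\mu)$ and, for $\gamma>1$, put $\varepsilon=\mu\sqrt{\gamma-1}$ (so $0<\varepsilon<1$ for $\gamma$ close to $1$). For $\Theta=(\theta_1,\theta_2)\in H^1_{\rm loc}(\mathbb R,\mathbb R^2)$ define, with values in $[0,\infty]$, $$I_{\mu,\gamma}(\Theta)=\frac12\int_{\mathbb R}\Big[\eta_\varepsilon(\mu y)^2\big((\theta_1')^2+(\theta_2')^2\big)+\frac{1}{2(\gamma-1)}\eta_\varepsilon(\mu y)^4(\theta_1^2+\theta_2^2-1)^2+\eta_\varepsilon(\mu y)^4\theta_1^2\theta_2^2\Big]\,dy,$$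 and for $\Theta\in L^2_{\rm loc}(\mathcal I_\mu,\mathbb R^2)$ define $$I_{\mu,1}(\Theta)=\frac12\int_{\mathcal I_\mu}\Big[\eta_0(\mu y)^2\big((\theta_1')^2+(\theta_2')^2\big)+\eta_0(\mu y)^4\theta_1^2\theta_2^2\Big]\,dy$$ if $\Theta\in H^1_{\rm loc}(\mathcal I_\mu,\mathbb R^2)$ and $\theta_1^2+\theta_2^2=1$ a.e. on $\mathcal I_\mu$, and $I_{\mu,1}(\Theta)=+\infty$ otherwise. Then: (i) (Compactness) Let $\gamma_n\to1^+$ and $\Theta_n\in H^1_{\rm loc}(\mathbb R,\mathbb R^2)$ be such that, for some $C<\infty$, $I_{\mu,\gamma_n}(\Theta_n)\le C$ for all large $n$. Then, along a subsequence, $\Theta_n\rightharpoonup\Theta$ weakly in $H^1_{\rm loc}(\mathcal I_\mu,\mathbb R^2)$ for some $\Theta\in H^1_{\rm loc}(\mathcal I_\mu,\mathbb R^2)$ whose continuous representative satisfies $|\Theta(y)|^2=1$ for every $y\in\mathcal I_\mu$. (ii) ($\Gamma$-liminf inequality) Let $\gamma_n\to1^+$, $\Theta_n\in H^1_{\rm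 loc}(\mathbb R,\mathbb R^2)$ and $\Theta\in L^2_{\rm loc}(\mathcal I_\mu,\mathbb R^2)$ be such that $\Theta_n\to\Theta$ in $L^2_{\rm loc}(\mathcal I_\mu,\mathbb R^2)$. Then $$\liminf_{n\to\infty}I_{\mu,\gamma_n}(\Theta_n)\ge I_{\mu,1}(\Theta).$$ (iii) ($\Gamma$-limsup inequality) For every $\Theta\in H^1_{\rm loc}(\mathcal I_\mu,\mathbb R^2)$ there are $\Theta_\gamma\in H^1_{\rm loc}(\mathbb R,\mathbb R^2)$, $\gamma>1$, such that, as $\gamma\to1^+$, $\Theta_\gamma\to\Theta$ in $L^2_{\rm loc}(\mathcal I_\mu,\mathbb R^2)$ and $$\limsup_{\gamma\to1^+}I_{\mu,\gamma}(\Theta_\gamma)\le I_{\mu,1}(\Theta).$$ -/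

import Mathlib

open MeasureTheory Filter Topology
open scoped ENNReal NNReal ContDiff

namespace DomainWall

/-- Two-component real profiles `Θ = (θ₁, θ₂)` on the line; `θ₁ = Θ · 0`, `θ₂ = Θ · 1`. -/
abbrev Profile : Type := ℝ → EuclideanSpace ℝ (Fin 2)

/-- The positive solution of `ε² η'' + (1 - x² - η²) η = 0` on the line in the energy space
`H¹(ℝ) ∩ L^{2,1}(ℝ)`, that is, `η`, `η'` and `x η` are square integrable. -/
structure IsGroundState (ε : ℝ) (η : ℝ → ℝ) : Prop where
  contDiff : ContDiff ℝ 2 η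
  pos : ∀ x, 0 < η x
  equation : ∀ x, ε ^ 2 * deriv (deriv η) x + (1 - x ^ 2 - η x ^ 2) * η x = 0
  memLp : MemLp η 2 volume
  memLp_deriv : MemLp (deriv η) 2 volume
  memLp_weight : MemLp (fun x => x * η x) 2 volume

/-- The Thomas--Fermi cloud `η₀(x) = √(1 - x²) 1_{|x| < 1}`. -/
noncomputable def thomasFermi (x : ℝ) : ℝ :=
  Set.indicator {x : ℝ | |x| < 1} (fun x => Real.sqrt (1 - x ^ 2)) x

/-- The interval `(-1/μ, 1/μ)`. -/
def cloudInterval (μ : ℝ) : Set ℝ := Set.Ioo (-(1 / μ)) (1 / μ)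

/-- `u ∈ L²_loc(U)`: square integrable on every compact subset of `U`. -/
def MemL2Loc {F : Type*} [NormedAddCommGroup F] (U : Set ℝ) (u : ℝ → F) : Prop :=
  ∀ K : Set ℝ, IsCompact K → K ⊆ U → MemLp u 2 (volume.restrict K)

/-- `g` is the weak derivative of `u` on the open set `U`, both being in `L²_loc(U)`. -/
structure HasWeakDerivOn (U : Set ℝ) (u g : ℝ → ℝ) : Prop where
  memL2Loc : MemL2Loc U u
  memL2Loc_deriv : MemL2Loc U g
  integral_eq : ∀ φ : ℝ → ℝ, ContDiff ℝ ∞ φ → HasCompactSupport φ → tsupport φ ⊆ U →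
    ∫ y in U, u y * deriv φ y = - ∫ y in U, g y * φ y

open Classical in
/-- The weak derivative of `u` on `U` (unique up to null sets in `U`); it is the zero function if
`u` is not in `H¹_loc(U)`. -/
noncomputable def weakDeriv (U : Set ℝ) (u : ℝ → ℝ) : ℝ → ℝ :=
  if h : ∃ g, HasWeakDerivOn U u g then h.choose else 0

/-- `Θ ∈ H¹_loc(U; ℝ²)`. -/
def MemH1Loc (U : Set ℝ) (Θ : Profile) : Prop :=
  ∀ i, ∃ g, HasWeakDerivOn U (fun y => Θ y i) g

/-- Convergence `Θₙ → Θ` in `L²_loc(U; ℝ²)`, along a filter. -/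
def TendstoL2Loc {ι : Type*} (U : Set ℝ) (Θs : ι → Profile) (l : Filter ι) (Θ : Profile) : Prop :=
  ∀ K : Set ℝ, IsCompact K → K ⊆ U →
    Tendsto (fun n => eLpNorm (fun y => Θs n y - Θ y) 2 (volume.restrict K)) l (𝓝 0)

/-- Weak convergence `Θₙ ⇀ Θ` in `H¹_loc(U; ℝ²)` for profiles in `H¹_loc(U; ℝ²)`: on every compact
subset of `U`, the components and their weak derivatives converge weakly in `L²`. -/
def TendstoWeaklyH1Loc {ι : Type*} (U : Set ℝ) (Θs : ι → Profile) (l : Filter ι) (Θ : Profile) :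
    Prop :=
  ∀ K : Set ℝ, IsCompact K → K ⊆ U → ∀ f : ℝ → ℝ, MemLp f 2 (volume.restrict K) → ∀ i,
    Tendsto (fun n => ∫ y in K, Θs n y i * f y) l (𝓝 (∫ y in K, Θ y i * f y)) ∧
    Tendsto (fun n => ∫ y in K, weakDeriv U (fun x => Θs n x i) y * f y) l
      (𝓝 (∫ y in K, weakDeriv U (fun x => Θ x i) y * f y))

/-- The functional `I_{μ,γ}` on `H¹_loc(ℝ; ℝ²)`, for `γ > 1`, with values in `[0, ∞]`; here
`ε = μ √(γ - 1)` and `η ε` is the ground state at `ε`. -/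
noncomputable def energy (η : ℝ → ℝ → ℝ) (μ γ : ℝ) (Θ : Profile) : ℝ≥0∞ :=
  (1 / 2) * ∫⁻ y : ℝ, ENNReal.ofReal (
    η (μ * √(γ - 1)) (μ * y) ^ 2 * weakDeriv Set.univ (fun x => Θ x 0) y ^ 2
    + η (μ * √(γ - 1)) (μ * y) ^ 2 * weakDeriv Set.univ (fun x => Θ x 1) y ^ 2
    + 1 / (2 * (γ - 1)) * η (μ * √(γ - 1)) (μ * y) ^ 4 * (Θ y 0 ^ 2 + Θ y 1 ^ 2 - 1) ^ 2
    + η (μ * √(γ - 1)) (μ * y) ^ 4 * Θ y 0 ^ 2 * Θ y 1 ^ 2)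

open Classical in
/-- The limit functional `I_{μ,1}`, with values in `[0, ∞]`: it is `∞` unless `Θ` is in `H¹_loc`
of the interval `(-1/μ, 1/μ)` and `θ₁² + θ₂² = 1` there. -/
noncomputable def limitEnergy (μ : ℝ) (Θ : Profile) : ℝ≥0∞ :=
  if MemH1Loc (cloudInterval μ) Θ ∧
      ∀ᵐ y ∂(volume.restrict (cloudInterval μ)), Θ y 0 ^ 2 + Θ y 1 ^ 2 = 1 then
    (1 / 2) * ∫⁻ y in cloudInterval μ, ENNReal.ofReal (
      thomasFermi (μ * y) ^ 2 * weakDeriv (cloudInterval μ) (fun x => Θ x 0) y ^ 2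
      + thomasFermi (μ * y) ^ 2 * weakDeriv (cloudInterval μ) (fun x => Θ x 1) y ^ 2
      + thomasFermi (μ * y) ^ 4 * Θ y 0 ^ 2 * Θ y 1 ^ 2)
  else ⊤

end DomainWall

namespace DomainWall

/-! ### The second derivative test and barriers for the ground state -/

/-! Everything needed about the ground state comes from comparison. At an interior maximum of `(δ² -
(x - x₀)²) η` the equation gives `η(x₀)² ≤ max 0 (1 - x₁²) + 8ε²/δ²`, and at a maximum of `(δ² - (x
- x₀)²)² / η` it gives `1 - x₁² - 4ε²/δ² ≤ η(x₀)²`, each for some `x₁` within `δ` of `x₀`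
(`exists_sq_le`, `exists_le_sq`). Different choices of `δ` yield `η ≤ 1`, decay outside the cloud, a
uniform positive lower bound on compact subsets of the cloud, and pointwise convergence to the
Thomas–Fermi profile.

Compactness and the liminf inequality share one argument, `exists_limit_profile`. With `wₙ` the
rescaled ground state, bounded energy bounds `wₙ θₙ'` in `L²`, and the penalty term bounds the
continuous representatives at the origin. A weak limit of `wₙ θₙ'` and a limit of the values at the
origin determine the limit profile as a primitive; pairing weak with strong convergence removes the
weight. The primitives converge pointwise, so Fatou's lemma handles the penalty, which forces unit
length, and the potential term, while weak lower semicontinuity of the norm handles the gradient.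
For the liminf inequality this is applied along a subsequence whose energies stay below an arbitrary
level above the liminf.

For recovery, the profile is frozen at its end values outside `[-r, r]` with `r < 1/μ`. Unit length
survives, so the penalty vanishes identically, and the energies converge by dominated convergence.
The limit exceeds the target by at most `1/μ - r`; a diagonal choice lets `r` tend to `1/μ` as `γ`
tends to `1`. -/

theorem second_deriv_nonneg_of_isLocalMin {f f' : ℝ → ℝ} {f'' x : ℝ}
    (hf : ∀ y, HasDerivAt f (f' y) y) (hf' : HasDerivAt f' f'' x) (hx : IsLocalMin f x) :
    0 ≤ f'' := by
  have hd : deriv f = f' := funext fun y => (hf y).deriv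
  have h2 : deriv (deriv f) x = f'' := by rw [hd]; exact hf'.deriv
  by_contra hneg
  -- A negative second derivative would make the local minimum a local maximum too, so `f` would be
  -- constant near `x` and its second derivative zero.
  have hmax : IsLocalMax f x :=
    isLocalMax_of_deriv_deriv_neg (by rw [h2]; linarith) hx.deriv_eq_zero
      (hf x).continuousAt
  have hconst : f =ᶠ[𝓝 x] fun _ => f x := by
    filter_upwards [hx, hmax] with y h₁ h₂ using le_antisymm h₂ h₁
  have h3 : deriv f =ᶠ[𝓝 x] fun _ => 0 := by
    filter_upwards [hconst.eventuallyEq_nhds] with y hy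
    rw [hy.deriv_eq]; simp
  have := h3.deriv_eq
  rw [h2] at this
  simp at this
  linarith

theorem second_deriv_nonpos_of_isLocalMax {f f' : ℝ → ℝ} {f'' x : ℝ}
    (hf : ∀ y, HasDerivAt f (f' y) y) (hf' : HasDerivAt f' f'' x) (hx : IsLocalMax f x) :
    f'' ≤ 0 := by
  have := second_deriv_nonneg_of_isLocalMin (fun y => (hf y).neg) hf'.neg hx.neg
  linarith

namespace IsGroundState

variable {ε : ℝ} {η : ℝ → ℝ}

theorem hasDerivAt (h : IsGroundState ε η) (x : ℝ) : HasDerivAt η (deriv η x) x :=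
  (h.contDiff.differentiable (by norm_num) x).hasDerivAt

theorem hasDerivAt_deriv (h : IsGroundState ε η) (x : ℝ) :
    HasDerivAt (deriv η) (deriv (deriv η) x) x := by
  have h1 : ContDiff ℝ 1 (deriv η) := h.contDiff.deriv'
  exact (h1.differentiable (by norm_num) x).hasDerivAt

theorem continuous (h : IsGroundState ε η) : Continuous η := h.contDiff.continuous

/-- A barrier of Keller--Osserman type bounds the ground state from above. -/
theorem exists_sq_le (h : IsGroundState ε η) (x₀ : ℝ) {δ : ℝ} (hδ : 0 < δ) :
    ∃ x₁, |x₁ - x₀| < δ ∧ η x₀ ^ 2 ≤ max 0 (1 - x₁ ^ 2) + 8 * ε ^ 2 / δ ^ 2 := by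
  set f : ℝ → ℝ := fun x => (δ ^ 2 - (x - x₀) ^ 2) * η x with hf
  have hne : (Set.Icc (x₀ - δ) (x₀ + δ)).Nonempty := ⟨x₀, by constructor <;> linarith⟩
  have hcont : Continuous f := by
    have := h.continuous
    fun_prop
  obtain ⟨x₁, hx₁, hmax⟩ := isCompact_Icc.exists_isMaxOn hne hcont.continuousOn
  have h0 : f x₀ ≤ f x₁ := hmax (by constructor <;> linarith)
  simp only [hf, sub_self] at h0
  have e0 := h.pos x₀
  have e1 := h.pos x₁
  -- The maximum is interior: `f` is positive at `x₀` and vanishes at the endpoints.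
  have hφ : 0 < δ ^ 2 - (x₁ - x₀) ^ 2 := by
    by_contra hc
    have : (δ ^ 2 - (x₁ - x₀) ^ 2) * η x₁ ≤ 0 :=
      mul_nonpos_of_nonpos_of_nonneg (not_lt.1 hc) e1.le
    have : 0 < δ ^ 2 * η x₀ := by positivity
    nlinarith
  have habs : |x₁ - x₀| < δ := abs_lt_of_sq_lt_sq (by linarith) hδ.le
  have hloc : IsLocalMax f x₁ := by
    refine hmax.isLocalMax (Icc_mem_nhds ?_ ?_) <;> rw [abs_lt] at habs <;> linarith
  have hd1 : ∀ y, HasDerivAt f (-(2 * (y - x₀)) * η y + (δ ^ 2 - (y - x₀) ^ 2) * deriv η y) y := by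
    intro y
    have := ((((hasDerivAt_id y).sub_const x₀).pow 2).const_sub (δ ^ 2)).mul (h.hasDerivAt y)
    refine this.congr_deriv ?_
    simp
  have hd2 : HasDerivAt
      (fun y => -(2 * (y - x₀)) * η y + (δ ^ 2 - (y - x₀) ^ 2) * deriv η y)
      (-2 * η x₁ - 4 * (x₁ - x₀) * deriv η x₁
        + (δ ^ 2 - (x₁ - x₀) ^ 2) * deriv (deriv η) x₁) x₁ := by
    have a := ((((hasDerivAt_id x₁).sub_const x₀).const_mul 2).neg).mul (h.hasDerivAt x₁)
    have b := ((((hasDerivAt_id x₁).sub_const x₀).pow 2).const_sub (δ ^ 2)).mul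
      (h.hasDerivAt_deriv x₁)
    refine (a.add b).congr_deriv ?_
    simp only [id_eq, Pi.pow_apply, Pi.neg_apply]
    push_cast
    ring
  have hz := hloc.hasDerivAt_eq_zero (hd1 x₁)
  have hn := second_deriv_nonpos_of_isLocalMax hd1 hd2 hloc
  have heq := h.equation x₁
  refine ⟨x₁, habs, ?_⟩
  generalize η x₀ = e₀ at *
  generalize η x₁ = e at *
  generalize deriv η x₁ = p at *
  generalize deriv (deriv η) x₁ = q at *
  generalize ht : x₁ - x₀ = t at *
  generalize hs : δ ^ 2 - t ^ 2 = s at *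
  -- Multiplying the second-order condition by `s` and eliminating `p` through `s p = 2 t e` leaves
  -- `2 e s + 8 t² e`; since `δ² = s + t²`, this is at most `8 δ² e`.
  have h1 : s ^ 2 * q ≤ 8 * δ ^ 2 * e := by
    have hsp : s * p = 2 * t * e := by linarith
    have hb : 4 * t * (s * p) = 8 * t ^ 2 * e := by rw [hsp]; ring
    have : s ^ 2 * q ≤ 2 * e * s + 8 * t ^ 2 * e := by
      linarith [mul_le_mul_of_nonneg_left hn hφ.le]
    have h' : 2 * e * s + 8 * t ^ 2 * e ≤ 8 * δ ^ 2 * e := by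
      have : 0 ≤ e * s := by positivity
      rw [← hs] at this ⊢
      nlinarith
    linarith
  have h2 : s ^ 2 * (e ^ 2 + x₁ ^ 2 - 1) ≤ 8 * δ ^ 2 * ε ^ 2 := by
    have h3 : s ^ 2 * (e ^ 2 + x₁ ^ 2 - 1) * e ≤ 8 * δ ^ 2 * ε ^ 2 * e := by
      have h4 : (e ^ 2 + x₁ ^ 2 - 1) * e = ε ^ 2 * q := by linarith
      calc s ^ 2 * (e ^ 2 + x₁ ^ 2 - 1) * e = ε ^ 2 * (s ^ 2 * q) := by rw [mul_assoc, h4]; ring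
        _ ≤ ε ^ 2 * (8 * δ ^ 2 * e) := by gcongr
        _ = _ := by ring
    exact le_of_mul_le_mul_right h3 e1
  have h3 : (δ ^ 2 * e₀) ^ 2 ≤ (s * e) ^ 2 := by
    have : 0 < δ ^ 2 * e₀ := by positivity
    exact pow_le_pow_left₀ this.le (by linarith) 2
  have h4 : s ^ 2 * (1 - x₁ ^ 2) ≤ δ ^ 4 * max 0 (1 - x₁ ^ 2) := by
    calc s ^ 2 * (1 - x₁ ^ 2) ≤ s ^ 2 * max 0 (1 - x₁ ^ 2) := by gcongr; exact le_max_right _ _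
      _ ≤ (δ ^ 2) ^ 2 * max 0 (1 - x₁ ^ 2) := by
        gcongr
        nlinarith [sq_nonneg t]
      _ = _ := by ring
  have h5 : δ ^ 4 * e₀ ^ 2 ≤ δ ^ 4 * (max 0 (1 - x₁ ^ 2) + 8 * ε ^ 2 / δ ^ 2) := by
    have : δ ^ 4 * (8 * ε ^ 2 / δ ^ 2) = 8 * δ ^ 2 * ε ^ 2 := by field_simp
    rw [mul_add, this]
    nlinarith
  exact le_of_mul_le_mul_left h5 (by positivity)

/-- A compactly supported barrier bounds the ground state from below. -/
theorem exists_le_sq (h : IsGroundState ε η) (x₀ : ℝ) {δ : ℝ} (hδ : 0 < δ) :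
    ∃ x₁, |x₁ - x₀| < δ ∧ 1 - x₁ ^ 2 - 4 * ε ^ 2 / δ ^ 2 ≤ η x₀ ^ 2 := by
  -- The square is essential: inside the interval `φ''/φ = (8t² - 4s)/s² ≥ -4/δ²` with `s = δ² -
  -- t²`, whereas without the square the ratio `-2/s` is unbounded below.
  set φ : ℝ → ℝ := fun x => (δ ^ 2 - (x - x₀) ^ 2) ^ 2 with hφdef
  have hne : (Set.Icc (x₀ - δ) (x₀ + δ)).Nonempty := ⟨x₀, by constructor <;> linarith⟩
  have hcont : Continuous fun x => φ x / η x := by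
    have := h.continuous
    exact Continuous.div (by fun_prop) this fun x => (h.pos x).ne'
  obtain ⟨x₁, hx₁, hmax⟩ := isCompact_Icc.exists_isMaxOn hne hcont.continuousOn
  have e0 := h.pos x₀
  have e1 := h.pos x₁
  have hle : ∀ y ∈ Set.Icc (x₀ - δ) (x₀ + δ), η x₁ * φ y ≤ φ x₁ * η y := by
    intro y hy
    have := hmax hy
    simp only [Set.mem_ofPred_eq] at this
    rw [div_le_div_iff₀ (h.pos y) e1] at this
    linarith
  have h0 := hle x₀ (by constructor <;> linarith)
  have hsq : (x₁ - x₀) ^ 2 ≤ δ ^ 2 := by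
    apply sq_le_sq'
    · linarith [hx₁.1]
    · linarith [hx₁.2]
  have hφ : 0 < δ ^ 2 - (x₁ - x₀) ^ 2 := by
    rcases hsq.lt_or_eq with hlt | heq
    · linarith
    · exfalso
      simp only [hφdef, heq, sub_self] at h0
      have : 0 < η x₁ * (δ ^ 2 - 0 ^ 2) ^ 2 := by
        have : 0 < δ ^ 2 - 0 ^ 2 := by simp; positivity
        positivity
      linarith
  have habs : |x₁ - x₀| < δ := abs_lt_of_sq_lt_sq (by linarith) hδ.le
  -- Clearing denominators in the maximality of `φ / η` avoids differentiating a quotient: this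
  -- function is nonnegative on the interval and vanishes at `x₁`.
  have hloc : IsLocalMin (fun y => φ x₁ * η y - η x₁ * φ y) x₁ := by
    have hm : Set.Icc (x₀ - δ) (x₀ + δ) ∈ 𝓝 x₁ := by
      rw [abs_lt] at habs
      exact Icc_mem_nhds (by linarith) (by linarith)
    filter_upwards [hm] with y hy
    have := hle y hy
    linarith
  have hd1 : ∀ y, HasDerivAt (fun y => φ x₁ * η y - η x₁ * φ y)
      (φ x₁ * deriv η y - η x₁ * (-4 * (y - x₀) * (δ ^ 2 - (y - x₀) ^ 2))) y := by
    intro y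
    have a := (((((hasDerivAt_id y).sub_const x₀).pow 2).const_sub (δ ^ 2)).pow 2).const_mul (η x₁)
    refine (((h.hasDerivAt y).const_mul (φ x₁)).sub a).congr_deriv ?_
    simp only [id_eq, Pi.pow_apply]
    push_cast
    ring
  have hd2 : HasDerivAt
      (fun y => φ x₁ * deriv η y - η x₁ * (-4 * (y - x₀) * (δ ^ 2 - (y - x₀) ^ 2)))
      (φ x₁ * deriv (deriv η) x₁
        - η x₁ * (8 * (x₁ - x₀) ^ 2 - 4 * (δ ^ 2 - (x₁ - x₀) ^ 2))) x₁ := by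
    have a := ((((hasDerivAt_id x₁).sub_const x₀).const_mul (-4)).mul
      ((((hasDerivAt_id x₁).sub_const x₀).pow 2).const_sub (δ ^ 2))).const_mul (η x₁)
    refine (((h.hasDerivAt_deriv x₁).const_mul (φ x₁)).sub a).congr_deriv ?_
    simp only [id_eq, Pi.pow_apply]
    push_cast
    ring
  have hn := second_deriv_nonneg_of_isLocalMin hd1 hd2 hloc
  have heq := h.equation x₁
  refine ⟨x₁, habs, ?_⟩
  simp only [hφdef, sub_self] at h0 hn
  generalize η x₀ = e₀ at *
  generalize η x₁ = e at *
  generalize deriv (deriv η) x₁ = q at *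
  generalize ht : x₁ - x₀ = t at *
  generalize hs : δ ^ 2 - t ^ 2 = s at *
  have hst : s ≤ δ ^ 2 := by nlinarith [sq_nonneg t]
  have h1 : -(4 * e) ≤ δ ^ 2 * q := by
    have h2 : s ^ 2 * -(4 * e) ≤ s ^ 2 * (δ ^ 2 * q) := by
      have h3 : δ ^ 2 * (e * (8 * t ^ 2 - 4 * s)) ≤ δ ^ 2 * (s ^ 2 * q) := by
        exact mul_le_mul_of_nonneg_left (by linarith) (sq_nonneg δ)
      -- After substituting `δ² = s + t²` the expression equals `4 s t² + 8 t⁴`.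
      have h4 : 0 ≤ δ ^ 2 * (8 * t ^ 2 - 4 * s) + 4 * s ^ 2 := by
        have : δ ^ 2 = s + t ^ 2 := by linarith
        rw [this]
        nlinarith [mul_nonneg hφ.le (sq_nonneg t), sq_nonneg (t ^ 2)]
      nlinarith [mul_nonneg e1.le h4]
    exact le_of_mul_le_mul_left h2 (by positivity)
  have h2 : δ ^ 2 * (1 - x₁ ^ 2 - e ^ 2) ≤ 4 * ε ^ 2 := by
    have h3 : δ ^ 2 * (1 - x₁ ^ 2 - e ^ 2) * e ≤ 4 * ε ^ 2 * e := by
      have h4 : (1 - x₁ ^ 2 - e ^ 2) * e = -(ε ^ 2 * q) := by linarith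
      calc δ ^ 2 * (1 - x₁ ^ 2 - e ^ 2) * e = ε ^ 2 * -(δ ^ 2 * q) := by rw [mul_assoc, h4]; ring
        _ ≤ ε ^ 2 * (4 * e) := by gcongr; linarith
        _ = _ := by ring
    exact le_of_mul_le_mul_right h3 e1
  have h3 : e ≤ e₀ := by
    have h4 : s ^ 2 * e ≤ s ^ 2 * e₀ := by
      calc s ^ 2 * e ≤ (δ ^ 2 - 0 ^ 2) ^ 2 * e := by
            gcongr
            linarith
        _ ≤ _ := by linarith
    exact le_of_mul_le_mul_left h4 (by positivity)
  have h4 : e ^ 2 ≤ e₀ ^ 2 := by gcongr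
  have h5 : 1 - x₁ ^ 2 - e ^ 2 ≤ 4 * ε ^ 2 / δ ^ 2 := by
    rw [le_div_iff₀ (by positivity)]
    linarith
  linarith

/-- In the upper barrier the first term never exceeds `1`, and the error `8ε²/δ²` disappears as `δ →
∞`. -/
theorem le_one (h : IsGroundState ε η) (x : ℝ) : η x ≤ 1 := by
  have h1 : η x ^ 2 ≤ 1 := by
    refine le_of_forall_pos_le_add fun τ hτ => ?_
    obtain ⟨n, hn⟩ := exists_nat_gt (8 * ε ^ 2 / τ)
    have hδ : (0 : ℝ) < n + 1 := by positivity
    obtain ⟨x₁, -, hx⟩ := h.exists_sq_le x hδ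
    refine hx.trans (add_le_add (max_le zero_le_one (by nlinarith [sq_nonneg x₁])) ?_)
    rw [div_lt_iff₀ hτ] at hn
    rw [div_le_iff₀ (by positivity)]
    have : (n : ℝ) ≤ (n + 1) ^ 2 := by nlinarith [n.cast_nonneg (α := ℝ)]
    nlinarith
  exact (abs_le_one_iff_mul_self_le_one.2 (by nlinarith) |> le_of_abs_le)

/-- Radius `|x| - 1` keeps the comparison point outside the cloud, so only the error term of the
upper barrier remains. -/
theorem sq_le_of_one_lt (h : IsGroundState ε η) {x : ℝ} (hx : 1 < |x|) :
    η x ^ 2 ≤ 8 * ε ^ 2 / (|x| - 1) ^ 2 := by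
  obtain ⟨x₁, h1, h2⟩ := h.exists_sq_le x (δ := |x| - 1) (by linarith)
  have : 1 ≤ |x₁| := by
    have := abs_sub_abs_le_abs_sub x x₁
    rw [abs_sub_comm] at this
    linarith
  have h3 : 1 - x₁ ^ 2 ≤ 0 := by
    rw [← sq_abs]
    nlinarith
  rwa [max_eq_left h3, zero_add] at h2

/-- A majorant independent of `ε` and integrable on the whole line, for dominated convergence of the
potential term. The constant is `8 · 8`: one factor from the decay estimate, one from `1 + x² ≤ 8
(|x| - 1)²` for `|x| ≥ 2`. -/
theorem pow_four_le (h : IsGroundState ε η) (hε : 0 < ε) (hε' : ε < 1) (x : ℝ) :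
    η x ^ 4 ≤ 64 / (1 + x ^ 2) := by
  have h1 := h.le_one x
  have h0 := (h.pos x).le
  rw [le_div_iff₀ (by positivity)]
  rcases le_total |x| 2 with hx | hx
  · have h2 : x ^ 2 ≤ 4 := by rw [← sq_abs]; nlinarith [abs_nonneg x]
    have h3 : η x ^ 4 ≤ 1 := pow_le_one₀ h0 h1
    nlinarith [pow_nonneg h0 4]
  · have h2 := h.sq_le_of_one_lt (x := x) (by linarith)
    rw [le_div_iff₀ (by nlinarith)] at h2
    have h3 : η x ^ 4 ≤ η x ^ 2 := pow_le_pow_of_le_one h0 h1 (by norm_num)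
    have h4 : 1 + x ^ 2 ≤ 8 * (|x| - 1) ^ 2 := by rw [← sq_abs x]; nlinarith
    have h5 : ε ^ 2 ≤ 1 := by nlinarith
    calc η x ^ 4 * (1 + x ^ 2) ≤ η x ^ 2 * (8 * (|x| - 1) ^ 2) := by gcongr
      _ ≤ 64 := by nlinarith

/-- The lower barrier is used with radius half the distance from `ρ` to the edge. Then `1 - x₁² ≥ k`
for every comparison point, and the threshold on `ε` makes the error at most `k / 2`. -/
theorem exists_pos_le {ρ : ℝ} (hρ : ρ < 1) :
    ∃ c > 0, ∃ ε₀ > 0, ∀ (ε : ℝ) (η : ℝ → ℝ), 0 < ε → ε < ε₀ → IsGroundState ε η →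
      ∀ x, |x| ≤ ρ → c ≤ η x := by
  rcases lt_or_ge ρ 0 with h0 | h0
  · exact ⟨1, one_pos, 1, one_pos, fun ε η _ _ _ x hx => absurd (abs_nonneg x) (by linarith)⟩
  set δ := (1 - ρ) / 2 with hδ
  have hδ0 : 0 < δ := by linarith
  have hk : 0 < 1 - (ρ + δ) ^ 2 := by nlinarith
  set k := 1 - (ρ + δ) ^ 2 with hkdef
  refine ⟨√(k / 2), by positivity, √(k * δ ^ 2 / 8), by positivity, ?_⟩
  intro ε η hε hε' h x hx
  obtain ⟨x₁, h1, h2⟩ := h.exists_le_sq x hδ0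
  rw [Real.lt_sqrt hε.le] at hε'
  refine Real.sqrt_le_iff.2 ⟨(h.pos x).le, le_trans ?_ h2⟩
  have h3 : |x₁| ≤ ρ + δ := by
    have := abs_sub_abs_le_abs_sub x₁ x
    linarith
  have h4 : x₁ ^ 2 ≤ (ρ + δ) ^ 2 := by rw [← sq_abs x₁]; gcongr
  have h5 : 4 * ε ^ 2 / δ ^ 2 ≤ k / 2 := by
    rw [div_le_iff₀ (by positivity)]
    linarith
  linarith

end IsGroundState

/-! ### The Thomas–Fermi profile as pointwise limit of the ground states -/

theorem thomasFermi_eq (x : ℝ) : thomasFermi x = √(max 0 (1 - x ^ 2)) := by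
  unfold thomasFermi Set.indicator
  split_ifs with h
  · have : x ^ 2 < 1 := by rw [← sq_abs]; simp at h; nlinarith [abs_nonneg x]
    rw [max_eq_right (by linarith)]
  · have : 1 ≤ x ^ 2 := by rw [← sq_abs]; simp at h; nlinarith [abs_nonneg x]
    rw [max_eq_left (by linarith), Real.sqrt_zero]

theorem thomasFermi_continuous : Continuous thomasFermi := by
  have : thomasFermi = fun x => √(max 0 (1 - x ^ 2)) := funext thomasFermi_eq
  rw [this]
  fun_prop

theorem thomasFermi_pos {x : ℝ} (hx : |x| < 1) : 0 < thomasFermi x := by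
  rw [thomasFermi_eq]
  have : x ^ 2 < 1 := by rw [← sq_abs]; nlinarith [abs_nonneg x]
  exact Real.sqrt_pos.2 (lt_max_of_lt_right (by linarith))

theorem thomasFermi_nonneg (x : ℝ) : 0 ≤ thomasFermi x := by
  rw [thomasFermi_eq]; positivity

theorem thomasFermi_le_one (x : ℝ) : thomasFermi x ≤ 1 := by
  rw [thomasFermi_eq]
  exact Real.sqrt_le_one.2 (max_le zero_le_one (by nlinarith [sq_nonneg x]))

/-- Both barriers compare `η²` at `x` with the limit at points within `δ`. Continuity of the limit
fixes `δ`; only then does `ε → 0` remove the errors, which are of order `ε²/δ²`. -/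
theorem tendsto_groundState {ι : Type*} {l : Filter ι} {ε : ι → ℝ} {η : ι → ℝ → ℝ}
    (hε : Tendsto ε l (𝓝 0)) (h : ∀ᶠ i in l, IsGroundState (ε i) (η i)) (x : ℝ) :
    Tendsto (fun i => η i x) l (𝓝 (thomasFermi x)) := by
  have hsq : Tendsto (fun i => η i x ^ 2) l (𝓝 (max 0 (1 - x ^ 2))) := by
    rw [Metric.tendsto_nhds]
    intro τ hτ
    have hc : Continuous fun y : ℝ => max 0 (1 - y ^ 2) := by fun_prop
    obtain ⟨δ, hδ, hcδ⟩ := Metric.continuous_iff.1 hc x (τ / 2) (by positivity)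
    have hlim : Tendsto (fun i => 8 * ε i ^ 2 / δ ^ 2) l (𝓝 0) := by
      have := ((hε.pow 2).const_mul 8).div_const (δ ^ 2)
      simpa using this
    filter_upwards [h, hlim.eventually (gt_mem_nhds (show (0 : ℝ) < τ / 2 by positivity))]
      with i hi hsmall
    obtain ⟨x₁, h1, h2⟩ := hi.exists_sq_le x hδ
    obtain ⟨x₂, h3, h4⟩ := hi.exists_le_sq x hδ
    have c1 := hcδ x₁ (by rwa [Real.dist_eq])
    have c2 := hcδ x₂ (by rwa [Real.dist_eq])
    rw [Real.dist_eq, abs_lt] at *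
    have h5 : 4 * ε i ^ 2 / δ ^ 2 ≤ 8 * ε i ^ 2 / δ ^ 2 := by
      gcongr
      norm_num
    have h6 : 0 ≤ 4 * ε i ^ 2 / δ ^ 2 := by positivity
    have h7 : max 0 (1 - x₂ ^ 2) - 4 * ε i ^ 2 / δ ^ 2 ≤ η i x ^ 2 := by
      rcases max_choice 0 (1 - x₂ ^ 2) with hm | hm <;> rw [hm]
      · nlinarith [sq_nonneg (η i x)]
      · exact h4
    constructor <;> linarith [c1.1, c1.2, c2.1, c2.2]
  have := hsq.sqrt
  rw [← thomasFermi_eq] at this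
  refine this.congr' ?_
  filter_upwards [h] with i hi
  exact Real.sqrt_sq (hi.pos x).le

/-! ### Weak derivatives on intervals -/

variable {U : Set ℝ} {u v g g' : ℝ → ℝ}

theorem MemL2Loc.mono {V : Set ℝ} (hu : MemL2Loc U u) (hVU : V ⊆ U) : MemL2Loc V u :=
  fun K hK hKV => hu K hK (hKV.trans hVU)

theorem MemL2Loc.integrableOn (hu : MemL2Loc U u) {K : Set ℝ} (hK : IsCompact K) (hKU : K ⊆ U) :
    IntegrableOn u K := by
  have : IsFiniteMeasure (volume.restrict K) := ⟨by simpa using hK.measure_lt_top⟩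
  exact (hu K hK hKU).integrable (by norm_num)

theorem MemL2Loc.locallyIntegrableOn (hu : MemL2Loc U u) (hU : IsOpen U) :
    LocallyIntegrableOn u U :=
  (locallyIntegrableOn_iff hU.isLocallyClosed).2 fun _ hKU hK => hu.integrableOn hK hKU

theorem MemL2Loc.sub (hu : MemL2Loc U u) (hv : MemL2Loc U v) :
    MemL2Loc U fun y => u y - v y :=
  fun K hK hKU => (hu K hK hKU).sub (hv K hK hKU)

theorem ae_restrict_of_subset {p : ℝ → Prop} {K : Set ℝ} (hKU : K ⊆ U)
    (h : ∀ᵐ y ∂(volume.restrict U), p y) : ∀ᵐ y ∂(volume.restrict K), p y :=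
  ae_mono (Measure.restrict_mono hKU le_rfl) h

theorem MemL2Loc.congr (hu : MemL2Loc U u) (h : u =ᵐ[volume.restrict U] v) : MemL2Loc U v :=
  fun K hK hKU => (hu K hK hKU).ae_eq (ae_restrict_of_subset hKU h)

theorem memLp_two_of_continuousOn {K : Set ℝ} (hK : IsCompact K) (hu : ContinuousOn u K) :
    MemLp u 2 (volume.restrict K) := by
  have : IsFiniteMeasure (volume.restrict K) := ⟨by simpa using hK.measure_lt_top⟩
  obtain ⟨C, hC⟩ := hK.exists_bound_of_continuousOn hu
  exact MemLp.of_bound (hu.aestronglyMeasurable hK.measurableSet) C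
    ((ae_restrict_iff' hK.measurableSet).2 (ae_of_all _ hC))

theorem memL2Loc_of_continuousOn (hu : ContinuousOn u U) : MemL2Loc U u :=
  fun _ hK hKU => memLp_two_of_continuousOn hK (hu.mono hKU)

theorem HasWeakDerivOn.congr (h : HasWeakDerivOn U u g) (hu : u =ᵐ[volume.restrict U] v)
    (hg : g =ᵐ[volume.restrict U] g') : HasWeakDerivOn U v g' where
  memL2Loc := h.memL2Loc.congr hu
  memL2Loc_deriv := h.memL2Loc_deriv.congr hg
  integral_eq φ h1 h2 h3 := by
    have e1 : ∫ y in U, v y * deriv φ y = ∫ y in U, u y * deriv φ y :=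
      integral_congr_ae (hu.mono fun y hy => by simp only [hy])
    have e2 : ∫ y in U, g' y * φ y = ∫ y in U, g y * φ y :=
      integral_congr_ae (hg.mono fun y hy => by simp only [hy])
    rw [e1, e2, h.integral_eq φ h1 h2 h3]

theorem eq_zero_of_notMem_tsupport {φ : ℝ → ℝ} (hφ : tsupport φ ⊆ U) {y : ℝ} (hy : y ∉ U) :
    φ y = 0 ∧ deriv φ y = 0 :=
  ⟨image_eq_zero_of_notMem_tsupport fun h => hy (hφ h),
    Function.notMem_support.1 fun h => hy (hφ (support_deriv_subset h))⟩

theorem HasWeakDerivOn.mono {V : Set ℝ} (h : HasWeakDerivOn U u g) (hVU : V ⊆ U) :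
    HasWeakDerivOn V u g where
  memL2Loc := h.memL2Loc.mono hVU
  memL2Loc_deriv := h.memL2Loc_deriv.mono hVU
  integral_eq φ h1 h2 h3 := by
    have key := h.integral_eq φ h1 h2 (h3.trans hVU)
    rw [setIntegral_eq_integral_of_forall_compl_eq_zero fun y hy => by
        rw [(eq_zero_of_notMem_tsupport (h3.trans hVU) hy).2, mul_zero],
      setIntegral_eq_integral_of_forall_compl_eq_zero fun y hy => by
        rw [(eq_zero_of_notMem_tsupport (h3.trans hVU) hy).1, mul_zero]] at key
    rw [setIntegral_eq_integral_of_forall_compl_eq_zero fun y hy => by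
        rw [(eq_zero_of_notMem_tsupport h3 hy).2, mul_zero],
      setIntegral_eq_integral_of_forall_compl_eq_zero fun y hy => by
        rw [(eq_zero_of_notMem_tsupport h3 hy).1, mul_zero], key]

theorem weakDeriv_spec (h : ∃ g, HasWeakDerivOn U u g) : HasWeakDerivOn U u (weakDeriv U u) := by
  unfold weakDeriv
  rw [dif_pos h]
  exact h.choose_spec

/-- A test function times a locally square integrable function is integrable. -/
theorem MemL2Loc.integrable_mul (hu : MemL2Loc U u) {φ : ℝ → ℝ} (hφ : Continuous φ)
    (hc : HasCompactSupport φ) (hs : tsupport φ ⊆ U) : Integrable fun y => u y * φ y := by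
  have h1 : IntegrableOn (fun y => u y * φ y) (tsupport φ) :=
    (hu.integrableOn hc hs).mul_continuousOn hφ.continuousOn hc
  refine (integrableOn_iff_integrable_of_support_subset ?_).1 h1
  intro y hy
  by_contra hn
  exact hy (by simp [image_eq_zero_of_notMem_tsupport hn])

/-- The difference of two weak derivatives integrates to zero against every test function, so the
fundamental lemma of the calculus of variations applies. -/
theorem HasWeakDerivOn.ae_eq (h : HasWeakDerivOn U u g) (h' : HasWeakDerivOn U u g')
    (hU : IsOpen U) : g =ᵐ[volume.restrict U] g' := by
  have key : ∀ᵐ x : ℝ, x ∈ U → g x - g' x = 0 := by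
    refine hU.ae_eq_zero_of_integral_contDiff_smul_eq_zero
      ((h.memL2Loc_deriv.sub h'.memL2Loc_deriv).locallyIntegrableOn hU) fun φ h1 h2 h3 => ?_
    have e := h.integral_eq φ h1 h2 h3
    rw [h'.integral_eq φ h1 h2 h3, neg_inj,
      setIntegral_eq_integral_of_forall_compl_eq_zero fun y hy => by
        rw [(eq_zero_of_notMem_tsupport h3 hy).1, mul_zero],
      setIntegral_eq_integral_of_forall_compl_eq_zero fun y hy => by
        rw [(eq_zero_of_notMem_tsupport h3 hy).1, mul_zero]] at e
    have i1 := h.memL2Loc_deriv.integrable_mul h1.continuous h2 h3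
    have i2 := h'.memL2Loc_deriv.integrable_mul h1.continuous h2 h3
    have : (fun x => φ x • (g x - g' x)) = fun x => g x * φ x - g' x * φ x := by
      ext x; simp only [smul_eq_mul]; ring
    rw [this, integral_sub i1 i2, e, sub_self]
  rw [Filter.EventuallyEq, ae_restrict_iff' hU.measurableSet]
  filter_upwards [key] with x hx hxU
  linarith [hx hxU]

theorem HasWeakDerivOn.ae_eq_weakDeriv (h : HasWeakDerivOn U u g) (hU : IsOpen U) :
    weakDeriv U u =ᵐ[volume.restrict U] g :=
  (weakDeriv_spec ⟨g, h⟩).ae_eq h hU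

/-- The margin at both ends makes functions supported in `K` vanish at `α` and `β`, so no boundary
terms appear in integrations by parts. -/
theorem exists_Icc_of_isCompact (hU : IsOpen U) (hU' : U.OrdConnected) {K : Set ℝ}
    (hK : IsCompact K) (hne : K.Nonempty) (hKU : K ⊆ U) :
    ∃ α β, α < β ∧ K ⊆ Set.Ioo α β ∧ Set.Icc α β ⊆ U := by
  have hi := hK.sInf_mem hne
  have hs := hK.sSup_mem hne
  obtain ⟨r, hr, hrU⟩ := Metric.isOpen_iff.1 hU _ (hKU hi)
  obtain ⟨s, hs', hsU⟩ := Metric.isOpen_iff.1 hU _ (hKU hs)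
  have hle : sInf K ≤ sSup K := csInf_le_csSup hne hK.bddBelow hK.bddAbove
  refine ⟨sInf K - r / 2, sSup K + s / 2, by linarith, fun y hy => ?_, hU'.out (hrU ?_) (hsU ?_)⟩
  · have := csInf_le hK.bddBelow hy
    have := le_csSup hK.bddAbove hy
    constructor <;> linarith
  · simp [abs_of_pos hr]
    linarith
  · simp [abs_of_pos hs']
    linarith

theorem MemL2Loc.intervalIntegrable (hg : MemL2Loc U g) (hU' : U.OrdConnected) {a b : ℝ}
    (ha : a ∈ U) (hb : b ∈ U) : IntervalIntegrable g volume a b := by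
  rw [intervalIntegrable_iff]
  exact (hg.integrableOn isCompact_uIcc (hU'.uIcc_subset ha hb)).mono_set Set.uIoc_subset_uIcc

theorem continuousOn_primitive (hU : IsOpen U) (hU' : U.OrdConnected) (h0 : 0 ∈ U)
    (hg : MemL2Loc U g) (a : ℝ) : ContinuousOn (fun y => a + ∫ t in (0 : ℝ)..y, g t) U := by
  intro y hy
  obtain ⟨α, β, hαβ, hK, hI⟩ := exists_Icc_of_isCompact hU hU' (K := {0, y})
    (Set.toFinite _).isCompact ⟨0, by simp⟩ (by rintro z (rfl | rfl) <;> assumption)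
  have i1 : IntervalIntegrable g volume α β :=
    hg.intervalIntegrable hU' (hI ⟨le_rfl, hαβ.le⟩) (hI ⟨hαβ.le, le_rfl⟩)
  have h0m : (0 : ℝ) ∈ Set.Ioo α β := hK (by simp)
  have hym : y ∈ Set.Ioo α β := hK (by simp)
  have hc := intervalIntegral.continuousOn_primitive_interval' i1
    (a := 0) (by rw [Set.uIcc_of_le hαβ.le]; exact Set.Ioo_subset_Icc_self h0m)
  rw [Set.uIcc_of_le hαβ.le] at hc
  exact ((hc.continuousAt (Icc_mem_nhds hym.1 hym.2)).const_add a).continuousWithinAt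

theorem setIntegral_eq_intervalIntegral {α β : ℝ} (hαβ : α ≤ β) (hI : Set.Icc α β ⊆ U)
    {f : ℝ → ℝ} (hf : ∀ y, y ∉ Set.Ioo α β → f y = 0) :
    ∫ y in U, f y = ∫ y in α..β, f y := by
  rw [intervalIntegral.integral_of_le hαβ,
    setIntegral_eq_integral_of_forall_compl_eq_zero fun y hy =>
      hf y fun h => hy (hI (Set.Ioo_subset_Icc_self h)),
    setIntegral_eq_integral_of_forall_compl_eq_zero fun y hy =>
      hf y fun h => hy (Set.Ioo_subset_Ioc_self h)]

/-- A primitive of a locally square integrable function has that function as weak derivative. -/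
theorem hasWeakDerivOn_primitive (hU : IsOpen U) (hU' : U.OrdConnected) (h0 : 0 ∈ U)
    (hg : MemL2Loc U g) (a : ℝ) :
    HasWeakDerivOn U (fun y => a + ∫ t in (0 : ℝ)..y, g t) g where
  memL2Loc := memL2Loc_of_continuousOn (continuousOn_primitive hU hU' h0 hg a)
  memL2Loc_deriv := hg
  integral_eq φ h1 h2 h3 := by
    obtain ⟨α, β, hαβ, hK, hI⟩ := exists_Icc_of_isCompact hU hU' (K := insert 0 (tsupport φ))
      (h2.isCompact.insert 0) ⟨0, by simp⟩ (Set.insert_subset h0 h3)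
    have h0m : (0 : ℝ) ∈ Set.uIcc α β := by
      rw [Set.uIcc_of_le hαβ.le]
      exact Set.Ioo_subset_Icc_self (hK (by simp))
    have i1 : IntervalIntegrable g volume α β :=
      hg.intervalIntegrable hU' (hI ⟨le_rfl, hαβ.le⟩) (hI ⟨hαβ.le, le_rfl⟩)
    have hsupp : tsupport φ ⊆ Set.Ioo α β := (Set.subset_insert _ _).trans hK
    have hz : ∀ y, y ∉ Set.Ioo α β → φ y = 0 ∧ deriv φ y = 0 :=
      fun y hy => eq_zero_of_notMem_tsupport hsupp hy
    rw [setIntegral_eq_intervalIntegral hαβ.le hI fun y hy => by rw [(hz y hy).2, mul_zero],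
      setIntegral_eq_intervalIntegral hαβ.le hI fun y hy => by rw [(hz y hy).1, mul_zero]]
    -- The primitive need not be `C¹`, so integration by parts is carried out for absolutely
    -- continuous functions, with Lebesgue differentiation recovering `g` almost everywhere.
    have ac0 := i1.absolutelyContinuousOnInterval_intervalIntegral h0m
    have acc : AbsolutelyContinuousOnInterval (fun _ : ℝ => a) α β :=
      (contDiff_const (n := 1)).contDiffOn.absolutelyContinuousOnInterval
    have acφ : AbsolutelyContinuousOnInterval φ α β :=
      (h1.of_le (by exact_mod_cast le_top)).contDiffOn.absolutelyContinuousOnInterval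
    have ibp := (acc.fun_add ac0).integral_mul_deriv_eq_deriv_mul acφ
    rw [(hz α (by simp)).1, (hz β (by simp)).1, mul_zero, mul_zero, sub_zero, zero_sub] at ibp
    rw [ibp, neg_inj]
    refine intervalIntegral.integral_congr_ae ?_
    filter_upwards [i1.ae_hasDerivAt_integral] with x hx hxm
    rw [((hx (Set.uIoc_subset_uIcc hxm) 0 h0m).const_add a).deriv]

/-- The du Bois-Reymond lemma. -/
theorem exists_ae_eq_const (hU : IsOpen U) (hU' : U.OrdConnected) (h0 : 0 ∈ U)
    (hv : MemL2Loc U v)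
    (h : ∀ φ : ℝ → ℝ, ContDiff ℝ ∞ φ → HasCompactSupport φ → tsupport φ ⊆ U →
      ∫ y in U, v y * deriv φ y = 0) :
    ∃ c, ∀ᵐ y ∂(volume.restrict U), v y = c := by
  obtain ⟨r, hr, hrU⟩ := Metric.nhds_basis_closedBall.mem_iff.1 (hU.mem_nhds h0)
  let b : ContDiffBump (0 : ℝ) := ⟨r / 2, r, by positivity, by linarith⟩
  set ρ : ℝ → ℝ := b.normed volume with hρ
  have ρ1 : ContDiff ℝ ∞ ρ := b.contDiff_normed
  have ρ2 : HasCompactSupport ρ := b.hasCompactSupport_normed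
  have ρ3 : tsupport ρ ⊆ U := by
    rw [hρ, b.tsupport_normed_eq]
    exact hrU
  have ρint : ∫ y, ρ y = 1 := b.integral_normed
  -- Since `ρ` has unit mass, the only possible constant is the average of `v` against `ρ`.
  refine ⟨∫ y, v y * ρ y, ?_⟩
  set c := ∫ y, v y * ρ y with hc
  have hconst : MemL2Loc U fun _ : ℝ => c := memL2Loc_of_continuousOn continuousOn_const
  have key : ∀ᵐ x : ℝ, x ∈ U → v x - c = 0 := by
    refine hU.ae_eq_zero_of_integral_contDiff_smul_eq_zero
      ((hv.sub hconst).locallyIntegrableOn hU) fun φ h1 h2 h3 => ?_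
    set m := ∫ y, φ y with hm
    -- Subtracting `m ρ` makes the mean zero, so the primitive of `ψ` is compactly supported and is
    -- itself an admissible test function.
    set ψ : ℝ → ℝ := fun y => φ y - m * ρ y with hψ
    have ψ1 : ContDiff ℝ ∞ ψ := h1.sub (contDiff_const.mul ρ1)
    have iφ : Integrable φ := h1.continuous.integrable_of_hasCompactSupport h2
    have iρ : Integrable ρ := ρ1.continuous.integrable_of_hasCompactSupport ρ2
    obtain ⟨α, β, hαβ, hK, hI⟩ := exists_Icc_of_isCompact hU hU'
      (K := insert 0 (tsupport φ ∪ tsupport ρ))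
      ((h2.isCompact.union ρ2.isCompact).insert 0) ⟨0, by simp⟩
      (Set.insert_subset h0 (Set.union_subset h3 ρ3))
    have hzφ : ∀ y, y ∉ Set.Ioo α β → φ y = 0 := fun y hy => (eq_zero_of_notMem_tsupport
      (Set.subset_union_left.trans ((Set.subset_insert _ _).trans hK)) hy).1
    have hzρ : ∀ y, y ∉ Set.Ioo α β → ρ y = 0 := fun y hy => (eq_zero_of_notMem_tsupport
      (Set.subset_union_right.trans ((Set.subset_insert _ _).trans hK)) hy).1
    have hzψ : ∀ y, y ∉ Set.Ioo α β → ψ y = 0 := fun y hy => by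
      simp [hψ, hzφ y hy, hzρ y hy]
    have ψint : ∫ y in α..β, ψ y = 0 := by
      rw [← setIntegral_eq_intervalIntegral (U := Set.univ) hαβ.le (Set.subset_univ _) hzψ,
        Measure.restrict_univ, hψ, integral_sub iφ (iρ.const_mul m), integral_const_mul, ρint]
      simp [hm]
    set Ψ : ℝ → ℝ := fun y => ∫ t in α..y, ψ t with hΨ
    have hder : ∀ y, HasDerivAt Ψ (ψ y) y := fun y =>
      (ψ1.continuous.integral_hasStrictDerivAt α y).hasDerivAt
    have hderiv : deriv Ψ = ψ := funext fun y => (hder y).deriv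
    have Ψ1 : ContDiff ℝ ∞ Ψ := by
      rw [contDiff_infty_iff_deriv, hderiv]
      exact ⟨fun y => (hder y).differentiableAt, ψ1⟩
    have hΨz : ∀ y, y ∉ Set.Icc α β → Ψ y = 0 := by
      intro y hy
      rcases lt_or_ge y α with hyα | hyα
      · refine (intervalIntegral.integral_congr (g := fun _ => 0) ?_).trans (by simp)
        intro t ht
        rw [Set.uIcc_of_ge hyα.le] at ht
        exact hzψ t fun h => absurd h.1 (not_lt.2 ht.2)
      · have hyβ : β < y := by
          by_contra hn
          exact hy ⟨hyα, not_lt.1 hn⟩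
        have hi : ∀ a b, IntervalIntegrable ψ volume a b :=
          fun a b => ψ1.continuous.intervalIntegrable a b
        rw [hΨ]
        simp only
        rw [← intervalIntegral.integral_add_adjacent_intervals (hi α β) (hi β y), ψint, zero_add]
        refine (intervalIntegral.integral_congr (g := fun _ => 0) ?_).trans (by simp)
        intro t ht
        rw [Set.uIcc_of_le hyβ.le] at ht
        exact hzψ t fun h => absurd h.2 (not_lt.2 ht.1)
    have hts : tsupport Ψ ⊆ Set.Icc α β :=
      closure_minimal (fun y hy => by by_contra hn; exact hy (hΨz y hn)) isClosed_Icc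
    have Ψ2 : HasCompactSupport Ψ := isCompact_Icc.of_isClosed_subset (isClosed_tsupport _) hts
    have e := h Ψ Ψ1 Ψ2 (hts.trans hI)
    rw [setIntegral_eq_integral_of_forall_compl_eq_zero fun y hy => by
        rw [(eq_zero_of_notMem_tsupport (hts.trans hI) hy).2, mul_zero], hderiv] at e
    have i1 := hv.integrable_mul h1.continuous h2 h3
    have i2 := hv.integrable_mul ρ1.continuous ρ2 ρ3
    have e2 : ∫ y, v y * ψ y = (∫ y, v y * φ y) - m * c := by
      rw [hc, ← integral_const_mul, ← integral_sub i1 (i2.const_mul m)]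
      congr 1
      ext y
      simp only [hψ]
      ring
    have e3 : ∫ y, φ y • (v y - c) = (∫ y, v y * φ y) - c * m := by
      rw [hm, ← integral_const_mul, ← integral_sub i1 (iφ.const_mul c)]
      congr 1
      ext y
      simp only [smul_eq_mul]
      ring
    rw [e3]
    linarith
  rw [ae_restrict_iff' hU.measurableSet]
  filter_upwards [key] with x hx hxU
  linarith [hx hxU]

/-- A function in `H¹_loc` of an interval is almost everywhere a primitive of its weak
derivative. -/
theorem HasWeakDerivOn.exists_ae_eq_primitive (h : HasWeakDerivOn U u g) (hU : IsOpen U)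
    (hU' : U.OrdConnected) (h0 : 0 ∈ U) :
    ∃ a, ∀ᵐ y ∂(volume.restrict U), u y = a + ∫ t in (0 : ℝ)..y, g t := by
  -- `u` and the primitive of `g` share the weak derivative `g`, so the du Bois-Reymond lemma
  -- applies to their difference.
  have hp := hasWeakDerivOn_primitive hU hU' h0 h.memL2Loc_deriv 0
  obtain ⟨c, hc⟩ := exists_ae_eq_const hU hU' h0 (h.memL2Loc.sub hp.memL2Loc)
    fun φ h1 h2 h3 => by
      have h1' : Continuous (deriv φ) := h1.continuous_deriv (by exact_mod_cast le_top)
      have h3' : tsupport (deriv φ) ⊆ U := tsupport_deriv_subset.trans h3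
      have i1 := h.memL2Loc.integrable_mul h1' h2.deriv h3'
      have i2 := hp.memL2Loc.integrable_mul h1' h2.deriv h3'
      have : (fun y => (u y - (0 + ∫ t in (0 : ℝ)..y, g t)) * deriv φ y) =
          fun y => u y * deriv φ y - (0 + ∫ t in (0 : ℝ)..y, g t) * deriv φ y := by
        ext y; ring
      rw [this, integral_sub i1.integrableOn i2.integrableOn, h.integral_eq φ h1 h2 h3,
        hp.integral_eq φ h1 h2 h3, sub_self]
  refine ⟨c, hc.mono fun y hy => ?_⟩
  linarith

/-! ### Weak convergence in `L²` -/

section WeakL2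

variable {ν : Measure ℝ} {f g : ℝ → ℝ}

theorem inner_toLp (hf : MemLp f 2 ν) (hg : MemLp g 2 ν) :
    inner ℝ (hf.toLp f) (hg.toLp g) = ∫ y, f y * g y ∂ν := by
  rw [L2.inner_def]
  refine integral_congr_ae ?_
  filter_upwards [hf.coeFn_toLp, hg.coeFn_toLp] with y h1 h2
  rw [h1, h2]
  simp [mul_comm]

theorem integrable_mul_of_memLp (hf : MemLp f 2 ν) (hg : MemLp g 2 ν) :
    Integrable (fun y => f y * g y) ν := hf.integrable_mul hg

theorem sq_integral_mul_le (hf : MemLp f 2 ν) (hg : MemLp g 2 ν) :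
    (∫ y, f y * g y ∂ν) ^ 2 ≤ (∫ y, f y ^ 2 ∂ν) * ∫ y, g y ^ 2 ∂ν := by
  have := real_inner_mul_inner_self_le (hf.toLp f) (hg.toLp g)
  rw [inner_toLp, inner_toLp, inner_toLp] at this
  simpa only [sq] using this

/-- Riesz representation turns the sequence into bounded functionals on a separable Hilbert space,
where closed balls are weak-* sequentially compact. -/
theorem exists_subseq_weak_limit {G : ℕ → ℝ → ℝ} {B : ℝ} (hG : ∀ n, MemLp (G n) 2 ν)
    (hB : ∀ n, ∫ y, G n y ^ 2 ∂ν ≤ B) [IsSeparable ν] :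
    ∃ (k : ℕ → ℕ) (G₀ : ℝ → ℝ), StrictMono k ∧ MemLp G₀ 2 ν ∧
      ∀ f, MemLp f 2 ν →
        Tendsto (fun n => ∫ y, G (k n) y * f y ∂ν) atTop (𝓝 (∫ y, G₀ y * f y ∂ν)) := by
  let H := Lp ℝ 2 ν
  let x : ℕ → WeakDual ℝ H := fun n =>
    StrongDual.toWeakDual (InnerProductSpace.toDual ℝ H ((hG n).toLp (G n)))
  have hx : ∀ n, x n ∈ WeakDual.toStrongDual ⁻¹' Metric.closedBall (0 : StrongDual ℝ H) (√B) := by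
    intro n
    have h1 : ‖(hG n).toLp (G n)‖ ≤ √B := by
      refine Real.le_sqrt_of_sq_le ?_
      rw [← real_inner_self_eq_norm_sq, inner_toLp]
      simpa only [sq] using hB n
    rw [Set.mem_preimage, mem_closedBall_zero_iff]
    have : ‖InnerProductSpace.toDual ℝ H ((hG n).toLp (G n))‖ ≤ √B := by
      rw [LinearIsometryEquiv.norm_map]
      exact h1
    exact this
  have hp : Fact ((2 : ℝ≥0∞) ≠ ⊤) := ⟨by norm_num⟩
  have hsc : SecondCountableTopology H := Lp.SecondCountableTopology
  obtain ⟨φ, -, k, hk, hlim⟩ := WeakDual.isSeqCompact_closedBall ℝ H 0 (√B) hx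
  set z : H := (InnerProductSpace.toDual ℝ H).symm (WeakDual.toStrongDual φ) with hz
  refine ⟨k, z, hk, Lp.memLp z, fun f hf => ?_⟩
  have h1 := ((WeakDual.eval_continuous (𝕜 := ℝ) (hf.toLp f)).tendsto φ).comp hlim
  have h2 : φ (hf.toLp f) = ∫ y, z y * f y ∂ν := by
    rw [← inner_toLp (Lp.memLp z) hf, Lp.toLp_coeFn, hz, InnerProductSpace.toDual_symm_apply]
    rfl
  rw [h2] at h1
  refine h1.congr fun n => ?_
  rw [← inner_toLp (hG (k n)) hf]
  rfl

/-- Split `Fₙ = F₀ + (Fₙ - F₀)`: the first pairing converges by hypothesis, the second is small by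
Cauchy–Schwarz and the bound on `Gₙ`. -/
theorem tendsto_integral_mul_of_weak_strong {G F : ℕ → ℝ → ℝ} {G₀ F₀ : ℝ → ℝ} {B : ℝ}
    (hG : ∀ n, MemLp (G n) 2 ν) (hB : ∀ n, ∫ y, G n y ^ 2 ∂ν ≤ B)
    (hF : ∀ᶠ n in atTop, MemLp (F n) 2 ν) (hF₀ : MemLp F₀ 2 ν)
    (hweak : Tendsto (fun n => ∫ y, G n y * F₀ y ∂ν) atTop (𝓝 (∫ y, G₀ y * F₀ y ∂ν)))
    (hstrong : Tendsto (fun n => ∫ y, (F n y - F₀ y) ^ 2 ∂ν) atTop (𝓝 0)) :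
    Tendsto (fun n => ∫ y, G n y * F n y ∂ν) atTop (𝓝 (∫ y, G₀ y * F₀ y ∂ν)) := by
  have hdiff : Tendsto (fun n => ∫ y, G n y * (F n y - F₀ y) ∂ν) atTop (𝓝 0) := by
    have hs : Tendsto (fun n => √(B * ∫ y, (F n y - F₀ y) ^ 2 ∂ν)) atTop (𝓝 0) := by
      simpa using (hstrong.const_mul B).sqrt
    refine squeeze_zero_norm' ?_ hs
    filter_upwards [hF] with n hn
    rw [Real.norm_eq_abs]
    refine Real.le_sqrt_of_sq_le ?_
    rw [sq_abs]
    refine (sq_integral_mul_le (hG n) (hn.sub hF₀)).trans ?_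
    exact mul_le_mul_of_nonneg_right (hB n) (integral_nonneg fun y => sq_nonneg _)
  have := hweak.add hdiff
  rw [add_zero] at this
  refine this.congr' ?_
  filter_upwards [hF] with n hn
  have hi : Integrable (fun y => G n y * (F n y - F₀ y)) ν :=
    integrable_mul_of_memLp (hG n) (hn.sub hF₀)
  rw [← integral_add (integrable_mul_of_memLp (hG n) hF₀) hi]
  exact integral_congr_ae (ae_of_all _ fun y => by ring)

end WeakL2

/-! ### Weighted bounds on an interval -/

/-- Weights `wₙ → w₀` on `U`, locally uniformly bounded away from zero, together with derivatives
`gₙ` for which `wₙ gₙ` converges weakly in `L²(U)` to `G`. -/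
structure WeightedLimit (U : Set ℝ) (w : ℕ → ℝ → ℝ) (w₀ : ℝ → ℝ) (g : ℕ → ℝ → ℝ) (G : ℝ → ℝ)
    (B : ℝ) : Prop where
  continuous : ∀ n, Continuous (w n)
  continuous_limit : Continuous w₀
  pos_limit : ∀ y ∈ U, 0 < w₀ y
  tendsto : ∀ y, Tendsto (fun n => w n y) atTop (𝓝 (w₀ y))
  lower : ∀ K : Set ℝ, IsCompact K → K ⊆ U → ∃ c > 0, ∀ᶠ n in atTop, ∀ y ∈ K, c ≤ w n y
  memL2Loc : ∀ n, MemL2Loc U (g n)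
  memLp : ∀ n, MemLp (fun y => w n y * g n y) 2 (volume.restrict U)
  bound : ∀ n, ∫ y in U, (w n y * g n y) ^ 2 ≤ B
  memLp_limit : MemLp G 2 (volume.restrict U)
  weak : ∀ f, MemLp f 2 (volume.restrict U) →
    Tendsto (fun n => ∫ y in U, (w n y * g n y) * f y) atTop (𝓝 (∫ y in U, G y * f y))

/-- Cauchy–Schwarz on the interval, with `c² g² ≤ (w g)²` converting the weighted bound into an
unweighted one. -/
theorem sq_primitive_le {U : Set ℝ} {w g : ℝ → ℝ}
    {B c : ℝ} (hc : 0 < c) (hg : MemL2Loc U g)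
    (hm : MemLp (fun y => w y * g y) 2 (volume.restrict U))
    (hB : ∫ y in U, (w y * g y) ^ 2 ≤ B) {α β : ℝ} (hI : Set.Icc α β ⊆ U)
    (hw : ∀ y ∈ Set.Icc α β, c ≤ w y) {x y : ℝ} (hx : x ∈ Set.Icc α β) (hy : y ∈ Set.Icc α β) :
    (∫ t in x..y, g t) ^ 2 ≤ B / c ^ 2 * (β - α) := by
  have hsub : Set.uIoc x y ⊆ Set.Icc α β :=
    Set.uIoc_subset_uIcc.trans (Set.ordConnected_Icc.uIcc_subset hx hy)
  have h1 : (∫ t in x..y, g t) ^ 2 = (∫ t in Set.uIoc x y, g t) ^ 2 := by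
    rw [← sq_abs, intervalIntegral.abs_intervalIntegral_eq, sq_abs]
  have hgm : MemLp g 2 (volume.restrict (Set.uIoc x y)) :=
    (hg _ isCompact_Icc hI).mono_measure (Measure.restrict_mono hsub le_rfl)
  have hfin : IsFiniteMeasure (volume.restrict (Set.uIoc x y)) :=
    ⟨by
      rw [Measure.restrict_apply_univ]
      exact (measure_mono hsub).trans_lt isCompact_Icc.measure_lt_top⟩
  have h2 := sq_integral_mul_le hgm (memLp_const (1 : ℝ))
  simp only [mul_one, one_pow, integral_const, smul_eq_mul, Measure.real,
    Measure.restrict_apply_univ] at h2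
  have hlen : (volume (Set.uIoc x y)).toReal ≤ β - α := by
    have : volume (Set.uIoc x y) ≤ ENNReal.ofReal (β - α) := by
      rw [← Real.volume_Icc]; exact measure_mono hsub
    have hαβ : 0 ≤ β - α := by linarith [hx.1, hx.2]
    exact ENNReal.toReal_le_of_le_ofReal hαβ this
  have h3 : c ^ 2 * ∫ t in Set.uIoc x y, g t ^ 2 ≤ B := by
    rw [← integral_const_mul]
    calc ∫ t in Set.uIoc x y, c ^ 2 * g t ^ 2
        ≤ ∫ t in Set.uIoc x y, (w t * g t) ^ 2 := by
          refine setIntegral_mono_on (hgm.integrable_sq.const_mul _)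
            ((hm.integrable_sq).mono_measure (Measure.restrict_mono (hsub.trans hI) le_rfl))
            measurableSet_uIoc fun t ht => ?_
          rw [mul_pow]
          have := hw t (hsub ht)
          gcongr
      _ ≤ ∫ t in U, (w t * g t) ^ 2 :=
          setIntegral_mono_set hm.integrable_sq (ae_of_all _ fun t => sq_nonneg _)
            ((hsub.trans hI).eventuallyLE)
      _ ≤ B := hB
  have h4 : ∫ t in Set.uIoc x y, g t ^ 2 ≤ B / c ^ 2 := by
    rw [le_div_iff₀ (by positivity)]; linarith
  rw [h1]
  refine h2.trans ?_
  have h5 : 0 ≤ ∫ t in Set.uIoc x y, g t ^ 2 := integral_nonneg fun t => sq_nonneg _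
  exact mul_le_mul h4 hlen ENNReal.toReal_nonneg (h5.trans h4)

namespace WeightedLimit

variable {U : Set ℝ} {w : ℕ → ℝ → ℝ} {w₀ : ℝ → ℝ} {g : ℕ → ℝ → ℝ} {G : ℝ → ℝ} {B : ℝ}

theorem exists_le_limit (h : WeightedLimit U w w₀ g G B) {K : Set ℝ} (hK : IsCompact K)
    (hKU : K ⊆ U) : ∃ c > 0, (∀ᶠ n in atTop, ∀ y ∈ K, c ≤ w n y) ∧ ∀ y ∈ K, c ≤ w₀ y := by
  obtain ⟨c, hc, hev⟩ := h.lower K hK hKU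
  exact ⟨c, hc, hev, fun y hy => ge_of_tendsto (h.tendsto y) (hev.mono fun n hn => hn y hy)⟩

theorem memLp_div {K : Set ℝ} (hK : IsCompact K) {v f : ℝ → ℝ} {c : ℝ}
    (hc : 0 < c) (hv : Continuous v) (hvc : ∀ y ∈ K, c ≤ v y)
    (hf : MemLp f 2 (volume.restrict K)) : MemLp (fun y => f y / v y) 2 (volume.restrict K) := by
  refine (hf.const_mul c⁻¹).mono ?_ ?_
  · exact hf.aestronglyMeasurable.div₀ hv.aestronglyMeasurable
  · refine (ae_restrict_iff' hK.measurableSet).2 (ae_of_all _ fun y hy => ?_)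
    have h1 := hvc y hy
    rw [norm_div, norm_mul, norm_inv, Real.norm_of_nonneg hc.le,
      Real.norm_of_nonneg (hc.le.trans h1), div_eq_inv_mul]
    gcongr

theorem memL2Loc_limit (h : WeightedLimit U w w₀ g G B) :
    MemL2Loc U fun y => G y / w₀ y := by
  intro K hK hKU
  obtain ⟨c, hc, -, hc'⟩ := h.exists_le_limit hK hKU
  exact memLp_div hK hc h.continuous_limit hc'
    (h.memLp_limit.mono_measure (Measure.restrict_mono hKU le_rfl))

/-- The derivatives converge weakly in `L²_loc`. -/
theorem tendsto_integral (h : WeightedLimit U w w₀ g G B)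
    {K : Set ℝ} (hK : IsCompact K) (hKU : K ⊆ U) {f : ℝ → ℝ}
    (hf : MemLp f 2 (volume.restrict K)) :
    Tendsto (fun n => ∫ y in K, g n y * f y) atTop (𝓝 (∫ y in K, G y / w₀ y * f y)) := by
  obtain ⟨c, hc, hev, hc'⟩ := h.exists_le_limit hK hKU
  have hind : ∀ {q : ℝ → ℝ}, MemLp q 2 (volume.restrict K) →
      MemLp (K.indicator q) 2 (volume.restrict U) := fun {q} hq =>
    ((memLp_indicator_iff_restrict hK.measurableSet).2 hq).mono_measure Measure.restrict_le_self
  -- On `K`, `gₙ f = (wₙ gₙ)(f / wₙ)` is a product of a weakly convergent factor and a strongly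
  -- convergent one; extension by zero allows testing on all of `U`.
  set F : ℕ → ℝ → ℝ := fun n => K.indicator fun y => f y / w n y with hFdef
  set F₀ : ℝ → ℝ := K.indicator fun y => f y / w₀ y with hF₀def
  have hF : ∀ᶠ n in atTop, MemLp (F n) 2 (volume.restrict U) := by
    filter_upwards [hev] with n hn
    exact hind (memLp_div hK hc (h.continuous n) hn hf)
  have hF₀ : MemLp F₀ 2 (volume.restrict U) := hind (memLp_div hK hc h.continuous_limit hc' hf)
  have hfK := hind hf
  have hbound : ∀ v : ℝ → ℝ, (∀ y ∈ K, c ≤ v y) → ∀ y,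
      |K.indicator (fun y => f y / v y) y| ≤ c⁻¹ * |K.indicator f y| := by
    intro v hv y
    by_cases hy : y ∈ K
    · have h1 := hv y hy
      simp only [Set.indicator_of_mem hy]
      rw [abs_div, abs_of_pos (hc.trans_le h1), div_eq_inv_mul]
      gcongr
    · simp [Set.indicator_of_notMem hy]
  have hstrong : Tendsto (fun n => ∫ y in U, (F n y - F₀ y) ^ 2) atTop (𝓝 0) := by
    have hz : (0 : ℝ) = ∫ y in U, (0 : ℝ) := by simp
    rw [hz]
    refine tendsto_integral_filter_of_dominated_convergence
      (fun y => 4 * c⁻¹ ^ 2 * K.indicator f y ^ 2) ?_ ?_ ?_ ?_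
    · filter_upwards [hF] with n hn
      exact (hn.sub hF₀).aestronglyMeasurable.pow 2
    · filter_upwards [hev] with n hn
      refine ae_of_all _ fun y => ?_
      have h1 := hbound (w n) hn y
      have h2 := hbound w₀ hc' y
      rw [Real.norm_eq_abs, abs_pow]
      have h3 : |F n y - F₀ y| ≤ 2 * (c⁻¹ * |K.indicator f y|) :=
        (abs_sub _ _).trans (by simp only [hFdef, hF₀def]; linarith)
      calc |F n y - F₀ y| ^ 2 ≤ (2 * (c⁻¹ * |K.indicator f y|)) ^ 2 := by gcongr
        _ = _ := by rw [mul_pow, mul_pow, sq_abs]; ring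
    · exact hfK.integrable_sq.const_mul _
    · refine ae_of_all _ fun y => ?_
      by_cases hy : y ∈ K
      · have h1 : Tendsto (fun n => f y / w n y) atTop (𝓝 (f y / w₀ y)) :=
          tendsto_const_nhds.div (h.tendsto y) (h.pos_limit y (hKU hy)).ne'
        have h2 := (h1.sub_const (f y / w₀ y)).pow 2
        simpa [hFdef, hF₀def, Set.indicator_of_mem hy] using h2
      · simp [hFdef, hF₀def, Set.indicator_of_notMem hy]
  have key := tendsto_integral_mul_of_weak_strong h.memLp h.bound hF hF₀ (h.weak F₀ hF₀) hstrong
  have hset : ∀ q p : ℝ → ℝ, ∫ y in U, q y * K.indicator p y = ∫ y in K, q y * p y := by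
    intro q p
    have : (fun y => q y * K.indicator p y) = K.indicator fun y => q y * p y := by
      ext y
      by_cases hy : y ∈ K <;> simp [hy]
    rw [this, setIntegral_indicator hK.measurableSet, Set.inter_eq_right.2 hKU]
  have e0 : ∫ y in U, G y * F₀ y = ∫ y in K, G y / w₀ y * f y := by
    rw [hF₀def, hset]
    congr 1
    ext y
    ring
  rw [e0] at key
  refine key.congr' ?_
  filter_upwards [hev] with n hn
  simp only [hFdef]
  rw [hset]
  refine setIntegral_congr_fun hK.measurableSet fun y hy => ?_
  have := (hc.trans_le (hn y hy)).ne'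
  field_simp

theorem tendsto_primitive (h : WeightedLimit U w w₀ g G B) (hU' : U.OrdConnected) {x y : ℝ}
    (hx : x ∈ U) (hy : y ∈ U) :
    Tendsto (fun n => ∫ t in x..y, g n t) atTop (𝓝 (∫ t in x..y, G t / w₀ t)) := by
  -- The test function is the constant `±1`, the sign recording the orientation of the interval
  -- integral.
  have key := h.tendsto_integral isCompact_uIcc (hU'.uIcc_subset hx hy)
    (f := fun _ => if x ≤ y then (1 : ℝ) else -1)
    (memLp_two_of_continuousOn isCompact_uIcc continuousOn_const)
  have e : ∀ q : ℝ → ℝ, ∫ t in x..y, q t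
      = ∫ t in Set.uIcc x y, q t * (if x ≤ y then (1 : ℝ) else -1) := by
    intro q
    rw [intervalIntegral.intervalIntegral_eq_integral_uIoc, integral_mul_const, smul_eq_mul,
      mul_comm]
    congr 1
    exact setIntegral_congr_set Ioc_ae_eq_Icc
  simp only [e]
  exact key

theorem exists_primitive_le (h : WeightedLimit U w w₀ g G B) (hU : IsOpen U)
    (hU' : U.OrdConnected) (h0 : 0 ∈ U) {K : Set ℝ} (hK : IsCompact K) (hKU : K ⊆ U) :
    ∃ M, ∀ᶠ n in atTop, ∀ y ∈ K, |∫ t in (0 : ℝ)..y, g n t| ≤ M := by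
  obtain ⟨α, β, hαβ, hK', hI⟩ := exists_Icc_of_isCompact hU hU' (K := insert 0 K)
    (hK.insert 0) ⟨0, by simp⟩ (Set.insert_subset h0 hKU)
  obtain ⟨c, hc, hev⟩ := h.lower _ isCompact_Icc hI
  refine ⟨√(B / c ^ 2 * (β - α)), ?_⟩
  filter_upwards [hev] with n hn y hy
  refine Real.abs_le_sqrt (sq_primitive_le hc (h.memL2Loc n) (h.memLp n) (h.bound n) hI hn
    (Set.Ioo_subset_Icc_self (hK' (by simp))) (Set.Ioo_subset_Icc_self (hK' (by simp [hy]))))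

/-- Dominated convergence: the primitives converge pointwise, since each value is a pairing with a
fixed function, and they are uniformly bounded on `K`. -/
theorem tendsto_integral_primitive (h : WeightedLimit U w w₀ g G B) (hU : IsOpen U)
    (hU' : U.OrdConnected) (h0 : 0 ∈ U) {a : ℕ → ℝ} {a₀ : ℝ} (ha : Tendsto a atTop (𝓝 a₀))
    {K : Set ℝ} (hK : IsCompact K) (hKU : K ⊆ U) {f : ℝ → ℝ}
    (hf : MemLp f 2 (volume.restrict K)) :
    Tendsto (fun n => ∫ y in K, (a n + ∫ t in (0 : ℝ)..y, g n t) * f y) atTop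
      (𝓝 (∫ y in K, (a₀ + ∫ t in (0 : ℝ)..y, G t / w₀ t) * f y)) := by
  obtain ⟨M, hM⟩ := h.exists_primitive_le hU hU' h0 hK hKU
  have hfin : IsFiniteMeasure (volume.restrict K) := ⟨by simpa using hK.measure_lt_top⟩
  refine tendsto_integral_filter_of_dominated_convergence (fun y => (|a₀| + 1 + M) * |f y|)
    ?_ ?_ ?_ ?_
  · refine Eventually.of_forall fun n => ?_
    exact (((continuousOn_primitive hU hU' h0 (h.memL2Loc n) (a n)).mono hKU).aestronglyMeasurable
      hK.measurableSet).mul hf.aestronglyMeasurable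
  · have : ∀ᶠ n in atTop, |a n| < |a₀| + 1 := ha.abs.eventually (gt_mem_nhds (by linarith))
    filter_upwards [this, hM] with n h1 h2
    refine (ae_restrict_iff' hK.measurableSet).2 (ae_of_all _ fun y hy => ?_)
    rw [norm_mul, Real.norm_eq_abs, Real.norm_eq_abs]
    have := h2 y hy
    gcongr
    exact (abs_add_le _ _).trans (by linarith)
  · exact ((hf.integrable (by norm_num)).abs).const_mul _
  · refine (ae_restrict_iff' hK.measurableSet).2 (ae_of_all _ fun y hy => ?_)
    exact (ha.add (h.tendsto_primitive hU' h0 (hKU hy))).mul_const _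

/-- Weak lower semicontinuity of the norm in linear form: `∫ (wₙ gₙ)² ≥ 2 ∫ wₙ gₙ G - ∫ G²`. The
right side has a genuine limit, not just a liminf, so it can later be combined with Fatou's lemma
for the potential term. -/
theorem tendsto_lower_bound (h : WeightedLimit U w w₀ g G B) :
    Tendsto (fun n => 2 * (∫ y in U, (w n y * g n y) * G y) - ∫ y in U, G y ^ 2) atTop
      (𝓝 (∫ y in U, G y ^ 2)) := by
  have := ((h.weak G h.memLp_limit).const_mul 2).sub_const (∫ y in U, G y ^ 2)
  have e : ∫ y in U, G y * G y = ∫ y in U, G y ^ 2 := by simp only [sq]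
  rw [e] at this
  convert this using 2
  ring

theorem lower_bound_le (h : WeightedLimit U w w₀ g G B) (n : ℕ) :
    2 * (∫ y in U, (w n y * g n y) * G y) - ∫ y in U, G y ^ 2
      ≤ ∫ y in U, (w n y * g n y) ^ 2 := by
  have h1 := (h.memLp n).integrable_sq
  have h2 := h.memLp_limit.integrable_sq
  have h3 := integrable_mul_of_memLp (h.memLp n) h.memLp_limit
  rw [← integral_const_mul, ← integral_sub (h3.const_mul 2) h2]
  refine integral_mono ((h3.const_mul 2).sub h2) h1 fun y => ?_
  simp only
  nlinarith [sq_nonneg (w n y * g n y - G y)]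

end WeightedLimit

/-! ### Compactness of sequences of bounded energy -/

theorem lintegral_le_of_energy_le {η : ℝ → ℝ → ℝ} {μ γ : ℝ} {Θ : Profile} {C : ℝ≥0}
    (h : energy η μ γ Θ ≤ C) :
    ∫⁻ y : ℝ, ENNReal.ofReal (
      η (μ * √(γ - 1)) (μ * y) ^ 2 * weakDeriv Set.univ (fun x => Θ x 0) y ^ 2
      + η (μ * √(γ - 1)) (μ * y) ^ 2 * weakDeriv Set.univ (fun x => Θ x 1) y ^ 2
      + 1 / (2 * (γ - 1)) * η (μ * √(γ - 1)) (μ * y) ^ 4 * (Θ y 0 ^ 2 + Θ y 1 ^ 2 - 1) ^ 2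
      + η (μ * √(γ - 1)) (μ * y) ^ 4 * Θ y 0 ^ 2 * Θ y 1 ^ 2) ≤ 2 * (C : ℝ≥0∞) := by
  unfold energy at h
  rw [one_div] at h
  calc _ = 2 * (2⁻¹ * ∫⁻ y : ℝ, ENNReal.ofReal (
      η (μ * √(γ - 1)) (μ * y) ^ 2 * weakDeriv Set.univ (fun x => Θ x 0) y ^ 2
      + η (μ * √(γ - 1)) (μ * y) ^ 2 * weakDeriv Set.univ (fun x => Θ x 1) y ^ 2
      + 1 / (2 * (γ - 1)) * η (μ * √(γ - 1)) (μ * y) ^ 4 * (Θ y 0 ^ 2 + Θ y 1 ^ 2 - 1) ^ 2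
      + η (μ * √(γ - 1)) (μ * y) ^ 4 * Θ y 0 ^ 2 * Θ y 1 ^ 2)) := by
        rw [← mul_assoc, ENNReal.mul_inv_cancel (by norm_num) (by norm_num), one_mul]
    _ ≤ _ := by gcongr

theorem memLp_of_lintegral_sq_le {ν : Measure ℝ} {f : ℝ → ℝ} {B : ℝ≥0}
    (hf : AEStronglyMeasurable f ν) (h : ∫⁻ y, ENNReal.ofReal (f y ^ 2) ∂ν ≤ B) :
    MemLp f 2 ν ∧ ∫ y, f y ^ 2 ∂ν ≤ B := by
  constructor
  · rw [memLp_two_iff_integrable_sq hf]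
    refine ⟨hf.pow 2, ?_⟩
    rw [hasFiniteIntegral_iff_ofReal (ae_of_all _ fun y => sq_nonneg _)]
    exact h.trans_lt ENNReal.coe_lt_top
  · rw [integral_eq_lintegral_of_nonneg_ae (ae_of_all _ fun y => sq_nonneg _) (hf.pow 2)]
    exact ENNReal.toReal_le_coe_of_le_coe h

theorem tendsto_ground_parameter {μ : ℝ} (hμ : 0 < μ) :
    Tendsto (fun γ : ℝ => μ * √(γ - 1)) (𝓝[>] 1) (𝓝 0) ∧
      ∀ᶠ γ in 𝓝[>] (1 : ℝ), 1 < γ ∧ 0 < μ * √(γ - 1) ∧ μ * √(γ - 1) < 1 := by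
  have h1 : Tendsto (fun γ : ℝ => μ * √(γ - 1)) (𝓝[>] 1) (𝓝 0) := by
    have hc : Continuous fun γ : ℝ => μ * √(γ - 1) := by fun_prop
    have := hc.tendsto 1
    simp only [sub_self, Real.sqrt_zero, mul_zero] at this
    exact this.mono_left nhdsWithin_le_nhds
  refine ⟨h1, ?_⟩
  filter_upwards [self_mem_nhdsWithin, h1.eventually (gt_mem_nhds one_pos)] with γ hγ h2
  have hγ' : 1 < γ := hγ
  exact ⟨hγ', mul_pos hμ (Real.sqrt_pos.2 (by linarith)), h2⟩

theorem abs_mul_lt_one {μ : ℝ} (hμ : 0 < μ) {y : ℝ} (hy : y ∈ cloudInterval μ) :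
    |μ * y| < 1 := by
  have h : |y| < 1 / μ := abs_lt.2 hy
  rw [abs_mul, abs_of_pos hμ]
  rwa [lt_div_iff₀ hμ, mul_comm] at h

theorem zero_mem_cloudInterval {μ : ℝ} (hμ : 0 < μ) : (0 : ℝ) ∈ cloudInterval μ := by
  have : 0 < 1 / μ := by positivity
  constructor <;> linarith

/-- On compact subsets of the cloud the ground states are bounded away from zero. -/
theorem exists_groundState_ge {η : ℝ → ℝ → ℝ}
    (hη : ∀ ε : ℝ, 0 < ε → ε < 1 → IsGroundState ε (η ε)) {μ : ℝ} (hμ : 0 < μ) {K : Set ℝ}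
    (hK : IsCompact K) (hKU : K ⊆ cloudInterval μ) :
    ∃ c > 0, ∀ᶠ γ in 𝓝[>] (1 : ℝ), ∀ y ∈ K, c ≤ η (μ * √(γ - 1)) (μ * y) := by
  obtain ⟨ρ, hρ, hρK⟩ : ∃ ρ < (1 : ℝ), ∀ y ∈ K, |μ * y| ≤ ρ := by
    rcases K.eq_empty_or_nonempty with rfl | hne
    · exact ⟨0, one_pos, by simp⟩
    · obtain ⟨y, hy, hmax⟩ := hK.exists_isMaxOn hne
        (f := fun y => |μ * y|) (by fun_prop)
      exact ⟨_, abs_mul_lt_one hμ (hKU hy), fun z hz => hmax hz⟩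
  obtain ⟨c, hc, ε₀, hε₀, h⟩ := IsGroundState.exists_pos_le hρ
  obtain ⟨hlim, hev⟩ := tendsto_ground_parameter hμ
  refine ⟨c, hc, ?_⟩
  filter_upwards [hev, hlim.eventually (gt_mem_nhds hε₀)] with γ h1 h2 y hy
  exact h _ _ h1.2.1 h2 (hη _ h1.2.1 h1.2.2) _ (hρK y hy)

/-- The energy bound controls the primitives at the origin. -/
theorem exists_bound_origin {R : ℝ} (hR : 0 < R) {w u₁ u₂ P : ℝ → ℝ} {c L : ℝ} {a : ℝ} {D : ℝ≥0}
    (hc : 0 < c) (hw : ∀ y ∈ Set.Icc (-(R / 2)) (R / 2), c ≤ w y)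
    (hP : ∀ y ∈ Set.Icc (-(R / 2)) (R / 2), P y ^ 2 ≤ L)
    (hu : ∀ᵐ y ∂(volume.restrict (Set.Icc (-(R / 2)) (R / 2))),
      (a + P y) ^ 2 ≤ u₁ y ^ 2 + u₂ y ^ 2)
    (hpen : ∫⁻ y in Set.Icc (-(R / 2)) (R / 2),
      ENNReal.ofReal (w y ^ 4 * (u₁ y ^ 2 + u₂ y ^ 2 - 1) ^ 2) ≤ D) :
    a ^ 2 ≤ 2 * (D / (c ^ 4 * R) + 2 + L) := by
  have h1 : ENNReal.ofReal (c ^ 4 * (a ^ 2 / 2 - 2 - L)) * ENNReal.ofReal R ≤ D := by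
    calc ENNReal.ofReal (c ^ 4 * (a ^ 2 / 2 - 2 - L)) * ENNReal.ofReal R
        = ∫⁻ _ in Set.Icc (-(R / 2)) (R / 2),
            ENNReal.ofReal (c ^ 4 * (a ^ 2 / 2 - 2 - L)) := by
          rw [setLIntegral_const, Real.volume_Icc]
          congr 2
          ring
      _ ≤ ∫⁻ y in Set.Icc (-(R / 2)) (R / 2),
            ENNReal.ofReal (w y ^ 4 * (u₁ y ^ 2 + u₂ y ^ 2 - 1) ^ 2) := by
          refine lintegral_mono_ae ?_
          filter_upwards [hu, ae_restrict_mem measurableSet_Icc] with y h2 hy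
          refine ENNReal.ofReal_le_ofReal ?_
          -- With `N = u₁² + u₂²`: `(N - 1)² ≥ N - 5/4`, `N ≥ (a + P)²`, and `(a + P)² ≥ a²/2 - P²`.
          have h3 : a ^ 2 / 2 - 2 - L ≤ (u₁ y ^ 2 + u₂ y ^ 2 - 1) ^ 2 := by
            have := hP y hy
            nlinarith [sq_nonneg (a + 2 * P y), sq_nonneg (u₁ y ^ 2 + u₂ y ^ 2 - 3 / 2)]
          have h4 : c ^ 4 ≤ w y ^ 4 := by
            have := hw y hy
            gcongr
          calc c ^ 4 * (a ^ 2 / 2 - 2 - L) ≤ c ^ 4 * (u₁ y ^ 2 + u₂ y ^ 2 - 1) ^ 2 := by gcongr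
            _ ≤ _ := by gcongr
      _ ≤ D := hpen
  rw [← ENNReal.ofReal_mul' hR.le] at h1
  have h2 : c ^ 4 * (a ^ 2 / 2 - 2 - L) * R ≤ D := by
    have := ENNReal.toReal_mono ENNReal.coe_ne_top h1
    rw [ENNReal.coe_toReal] at this
    exact (Real.le_coe_toNNReal _).trans this
  have h3 : a ^ 2 / 2 - 2 - L ≤ D / (c ^ 4 * R) := by
    rw [le_div_iff₀ (by positivity)]
    linarith
  linarith

/-- The weak limit of derivatives together with the limit of the values at the origin. -/
theorem exists_subseq_limit {U : Set ℝ} {G : ℕ → ℝ → ℝ} {a : ℕ → ℝ} {A B : ℝ}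
    (hG : ∀ n, MemLp (G n) 2 (volume.restrict U)) (hB : ∀ n, ∫ y in U, G n y ^ 2 ≤ B)
    (ha : ∀ᶠ n in atTop, |a n| ≤ A) :
    ∃ (k : ℕ → ℕ) (G₀ : ℝ → ℝ) (a₀ : ℝ), StrictMono k ∧ MemLp G₀ 2 (volume.restrict U) ∧
      (∀ f, MemLp f 2 (volume.restrict U) →
        Tendsto (fun n => ∫ y in U, G (k n) y * f y) atTop (𝓝 (∫ y in U, G₀ y * f y))) ∧
      Tendsto (fun n => a (k n)) atTop (𝓝 a₀) := by
  obtain ⟨k₁, G₀, hk₁, hG₀, hw⟩ := exists_subseq_weak_limit hG hB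
  obtain ⟨a₀, -, k₂, hk₂, hlim⟩ := tendsto_subseq_of_frequently_bounded
    (Metric.isBounded_closedBall (x := (0 : ℝ)) (r := A)) (x := fun n => a (k₁ n))
    (((hk₁.tendsto_atTop.eventually ha).mono fun n hn => by
      simpa [Real.norm_eq_abs] using hn).frequently)
  exact ⟨k₁ ∘ k₂, G₀, a₀, hk₁.comp hk₂, hG₀,
    fun f hf => (hw f hf).comp hk₂.tendsto_atTop, hlim⟩

/-- Compactness: a sequence of bounded energy has a subsequence converging to a unit profile whose
limit energy obeys the same bound. -/
theorem exists_limit_profile {η : ℝ → ℝ → ℝ}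
    (hη : ∀ ε : ℝ, 0 < ε → ε < 1 → IsGroundState ε (η ε)) {μ : ℝ} (hμ : 0 < μ)
    {γ : ℕ → ℝ} {Θs : ℕ → Profile} (hγ : Tendsto γ atTop (𝓝[>] 1))
    (hγ' : ∀ n, 1 < γ n ∧ 0 < μ * √(γ n - 1) ∧ μ * √(γ n - 1) < 1)
    (hΘ : ∀ n, MemH1Loc Set.univ (Θs n)) {C : ℝ≥0} (hC : ∀ n, energy η μ (γ n) (Θs n) ≤ C) :
    ∃ (k : ℕ → ℕ) (Θ : Profile), StrictMono k ∧ MemH1Loc (cloudInterval μ) Θ ∧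
      TendstoWeaklyH1Loc (cloudInterval μ) (fun n => Θs (k n)) atTop Θ ∧
      ContinuousOn Θ (cloudInterval μ) ∧ (∀ y ∈ cloudInterval μ, ‖Θ y‖ ^ 2 = 1) ∧
      (∀ᵐ y ∂(volume.restrict (cloudInterval μ)),
        Tendsto (fun n => Θs (k n) y) atTop (𝓝 (Θ y))) ∧
      limitEnergy μ Θ ≤ C := by
  set U := cloudInterval μ with hUdef
  have hU : IsOpen U := isOpen_Ioo
  have hU' : U.OrdConnected := Set.ordConnected_Ioo
  have h0 : (0 : ℝ) ∈ U := zero_mem_cloudInterval hμ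
  set w : ℕ → ℝ → ℝ := fun n y => η (μ * √(γ n - 1)) (μ * y) with hw
  set w₀ : ℝ → ℝ := fun y => thomasFermi (μ * y) with hw₀
  set g : ℕ → Fin 2 → ℝ → ℝ := fun n i => weakDeriv Set.univ fun x => Θs n x i with hg
  have hgs : ∀ n, IsGroundState (μ * √(γ n - 1)) (η (μ * √(γ n - 1))) :=
    fun n => hη _ (hγ' n).2.1 (hγ' n).2.2
  have wcont : ∀ n, Continuous (w n) := fun n => (hgs n).continuous.comp (by fun_prop)
  have w0cont : Continuous w₀ := thomasFermi_continuous.comp (by fun_prop)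
  have w0pos : ∀ y ∈ U, 0 < w₀ y := fun y hy => thomasFermi_pos (abs_mul_lt_one hμ hy)
  have wlim : ∀ y, Tendsto (fun n => w n y) atTop (𝓝 (w₀ y)) := fun y =>
    tendsto_groundState ((tendsto_ground_parameter hμ).1.comp hγ) (Eventually.of_forall hgs) _
  have wlow : ∀ K : Set ℝ, IsCompact K → K ⊆ U →
      ∃ c > 0, ∀ᶠ n in atTop, ∀ y ∈ K, c ≤ w n y := fun K hK hKU => by
    obtain ⟨c, hc, hev⟩ := exists_groundState_ge hη hμ hK hKU
    exact ⟨c, hc, hγ.eventually hev⟩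
  have hderiv : ∀ n i, HasWeakDerivOn U (fun y => Θs n y i) (g n i) := fun n i =>
    (weakDeriv_spec (hΘ n i)).mono (Set.subset_univ U)
  have gL2 : ∀ n i, MemL2Loc U (g n i) := fun n i => (hderiv n i).memL2Loc_deriv
  have gmeas : ∀ n i, AEStronglyMeasurable (g n i) (volume.restrict U) := fun n i =>
    ((gL2 n i).locallyIntegrableOn hU).aestronglyMeasurable
  have Θmeas : ∀ n i, AEStronglyMeasurable (fun y => Θs n y i) (volume.restrict U) := fun n i =>
    ((hderiv n i).memL2Loc.locallyIntegrableOn hU).aestronglyMeasurable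
  -- `a n i` is the value at the origin of the continuous representative of the component.
  choose a ha using fun n i => (hderiv n i).exists_ae_eq_primitive hU hU' h0
  have hE : ∀ n, ∫⁻ y in U, ENNReal.ofReal (w n y ^ 2 * g n 0 y ^ 2 + w n y ^ 2 * g n 1 y ^ 2
      + 1 / (2 * (γ n - 1)) * w n y ^ 4 * (Θs n y 0 ^ 2 + Θs n y 1 ^ 2 - 1) ^ 2
      + w n y ^ 4 * Θs n y 0 ^ 2 * Θs n y 1 ^ 2) ≤ (2 * C : ℝ≥0) := fun n => by
    refine (setLIntegral_le_lintegral _ _).trans ?_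
    rw [ENNReal.coe_mul]
    exact lintegral_le_of_energy_le (hC n)
  have hpen0 : ∀ n y, 0 ≤ 1 / (2 * (γ n - 1)) * w n y ^ 4
      * (Θs n y 0 ^ 2 + Θs n y 1 ^ 2 - 1) ^ 2 := fun n y => by
    have : 0 < γ n - 1 := by linarith [(hγ' n).1]
    positivity
  have hEg : ∀ n i, ∫⁻ y in U, ENNReal.ofReal ((w n y * g n i y) ^ 2) ≤ (2 * C : ℝ≥0) := by
    intro n i
    refine (lintegral_mono fun y => ENNReal.ofReal_le_ofReal ?_).trans (hE n)
    have h1 := hpen0 n y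
    have h2 : 0 ≤ w n y ^ 4 * Θs n y 0 ^ 2 * Θs n y 1 ^ 2 := by positivity
    have h3 : 0 ≤ w n y ^ 2 * g n 0 y ^ 2 := by positivity
    have h4 : 0 ≤ w n y ^ 2 * g n 1 y ^ 2 := by positivity
    rw [mul_pow]
    fin_cases i <;> simp only [Fin.zero_eta, Fin.mk_one] <;> linarith
  -- Clearing the prefactor `1 / (2(γₙ - 1))` leaves a bound that tends to zero; this is what forces
  -- the limit onto the unit circle.
  have hEpen : ∀ n, ∫⁻ y in U, ENNReal.ofReal (w n y ^ 4 *
      (Θs n y 0 ^ 2 + Θs n y 1 ^ 2 - 1) ^ 2)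
      ≤ ENNReal.ofReal (2 * (γ n - 1)) * (2 * C : ℝ≥0) := by
    intro n
    have hpos : 0 < 2 * (γ n - 1) := by linarith [(hγ' n).1]
    refine le_trans ?_ (mul_le_mul_right (hE n) _)
    rw [← lintegral_const_mul' _ _ ENNReal.ofReal_ne_top]
    refine lintegral_mono fun y => ?_
    rw [← ENNReal.ofReal_mul hpos.le]
    refine ENNReal.ofReal_le_ofReal ?_
    have h2 : 0 ≤ w n y ^ 4 * Θs n y 0 ^ 2 * Θs n y 1 ^ 2 := by positivity
    have h3 : 0 ≤ w n y ^ 2 * g n 0 y ^ 2 := by positivity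
    have h4 : 0 ≤ w n y ^ 2 * g n 1 y ^ 2 := by positivity
    calc w n y ^ 4 * (Θs n y 0 ^ 2 + Θs n y 1 ^ 2 - 1) ^ 2
        = 2 * (γ n - 1) * (1 / (2 * (γ n - 1)) * w n y ^ 4
          * (Θs n y 0 ^ 2 + Θs n y 1 ^ 2 - 1) ^ 2) := by
          have : γ n - 1 ≠ 0 := by linarith
          field_simp
      _ ≤ _ := mul_le_mul_of_nonneg_left (by linarith) hpos.le
  have hmem : ∀ n i, MemLp (fun y => w n y * g n i y) 2 (volume.restrict U) ∧
      ∫ y in U, (w n y * g n i y) ^ 2 ≤ (2 * C : ℝ≥0) := fun n i =>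
    memLp_of_lintegral_sq_le ((wcont n).aestronglyMeasurable.mul (gmeas n i)) (hEg n i)
  -- the values at the origin are bounded
  obtain ⟨A, hA⟩ : ∃ A, ∀ᶠ n in atTop, ∀ i, |a n i| ≤ A := by
    set R := 1 / μ with hR
    have hRpos : 0 < R := by positivity
    have hI : Set.Icc (-(R / 2)) (R / 2) ⊆ U := by
      intro y hy
      constructor <;> linarith [hy.1, hy.2]
    obtain ⟨c, hc, hev⟩ := wlow _ isCompact_Icc hI
    -- This makes `2(γₙ - 1) ≤ 2`, so the penalty integral is at most `4C`.
    have hsmall : ∀ᶠ n in atTop, γ n ≤ 2 :=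
      (hγ.mono_right nhdsWithin_le_nhds).eventually (ge_mem_nhds (by norm_num))
    refine ⟨√(2 * ((4 * C : ℝ≥0) / (c ^ 4 * R) + 2
      + (2 * C : ℝ≥0) / c ^ 2 * (R / 2 - -(R / 2)))), ?_⟩
    filter_upwards [hev, hsmall] with n hn hn2 i
    refine Real.abs_le_sqrt (exists_bound_origin (w := w n) (u₁ := fun y => Θs n y 0)
      (u₂ := fun y => Θs n y 1) (P := fun y => ∫ t in (0 : ℝ)..y, g n i t) hRpos hc hn ?_ ?_ ?_)
    · intro y hy
      exact sq_primitive_le hc (gL2 n i) (hmem n i).1 (hmem n i).2 hI hn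
        ⟨by linarith, by linarith⟩ hy
    · filter_upwards [ae_restrict_of_subset hI (ha n i)] with y hy
      rw [← hy]
      fin_cases i <;> simp only [Fin.zero_eta, Fin.mk_one]
      · nlinarith [sq_nonneg (Θs n y 1)]
      · nlinarith [sq_nonneg (Θs n y 0)]
    · refine (lintegral_mono_set hI).trans ((hEpen n).trans ?_)
      calc ENNReal.ofReal (2 * (γ n - 1)) * (2 * C : ℝ≥0)
          ≤ ENNReal.ofReal 2 * (2 * C : ℝ≥0) := by
            gcongr
            linarith
        _ = (4 * C : ℝ≥0) := by
            rw [ENNReal.ofReal_ofNat, ENNReal.coe_mul, ENNReal.coe_mul, ← mul_assoc]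
            norm_num
  -- extraction
  obtain ⟨k₁, G₀, b₀, hk₁, hG₀, hweak₀, hb₀⟩ := exists_subseq_limit
    (fun n => (hmem n 0).1) (fun n => (hmem n 0).2) (hA.mono fun n hn => hn 0)
  obtain ⟨k₂, G₁, b₁, hk₂, hG₁, hweak₁, hb₁⟩ := exists_subseq_limit
    (fun n => (hmem (k₁ n) 1).1) (fun n => (hmem (k₁ n) 1).2)
    (a := fun n => a (k₁ n) 1) (hk₁.tendsto_atTop.eventually (hA.mono fun n hn => hn 1))
  set k : ℕ → ℕ := k₁ ∘ k₂ with hk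
  have kmono : StrictMono k := hk₁.comp hk₂
  set G : Fin 2 → ℝ → ℝ := ![G₀, G₁] with hG
  set b : Fin 2 → ℝ := ![b₀, b₁] with hb
  have hlim : ∀ i, WeightedLimit U (fun n => w (k n)) w₀ (fun n => g (k n) i) (G i)
      (2 * C : ℝ≥0) := by
    intro i
    refine ⟨fun n => wcont _, w0cont, w0pos, fun y => (wlim y).comp kmono.tendsto_atTop,
      fun K hK hKU => ?_, fun n => gL2 _ _, fun n => (hmem _ _).1, fun n => (hmem _ _).2, ?_, ?_⟩
    · obtain ⟨c, hc, hev⟩ := wlow K hK hKU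
      exact ⟨c, hc, kmono.tendsto_atTop.eventually hev⟩
    · fin_cases i
      · exact hG₀
      · exact hG₁
    · intro f hf
      fin_cases i
      · exact (hweak₀ f hf).comp hk₂.tendsto_atTop
      · exact hweak₁ f hf
  have hbl : ∀ i, Tendsto (fun n => a (k n) i) atTop (𝓝 (b i)) := by
    intro i
    fin_cases i
    · exact hb₀.comp hk₂.tendsto_atTop
    · exact hb₁
  -- Since `wₙ θₙ'` tends weakly to `G` and `wₙ` tends to `w₀`, the derivative of the limit must be
  -- `G / w₀`.
  set u : Fin 2 → ℝ → ℝ := fun i y => b i + ∫ t in (0 : ℝ)..y, G i t / w₀ t with hu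
  have ucont : ∀ i, ContinuousOn (u i) U := fun i =>
    continuousOn_primitive hU hU' h0 (hlim i).memL2Loc_limit (b i)
  have uderiv : ∀ i, HasWeakDerivOn U (u i) fun y => G i y / w₀ y := fun i =>
    hasWeakDerivOn_primitive hU hU' h0 (hlim i).memL2Loc_limit (b i)
  have haek : ∀ᵐ y ∂(volume.restrict U), ∀ n i,
      Θs (k n) y i = a (k n) i + ∫ t in (0 : ℝ)..y, g (k n) i t :=
    ae_all_iff.2 fun n => ae_all_iff.2 fun i => ha (k n) i
  have hptw : ∀ᵐ y ∂(volume.restrict U), ∀ i,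
      Tendsto (fun n => Θs (k n) y i) atTop (𝓝 (u i y)) := by
    filter_upwards [haek, ae_restrict_mem hU.measurableSet] with y hy hyU i
    simp only [hy]
    exact (hbl i).add ((hlim i).tendsto_primitive hU' h0 hyU)
  have hunit_ae : ∀ᵐ y ∂(volume.restrict U), u 0 y ^ 2 + u 1 y ^ 2 = 1 := by
    -- Fatou's lemma applied to the penalty, whose integrals tend to zero.
    have hF : ∫⁻ y in U, liminf (fun n => ENNReal.ofReal (w (k n) y ^ 4 *
        (Θs (k n) y 0 ^ 2 + Θs (k n) y 1 ^ 2 - 1) ^ 2)) atTop ≤ 0 := by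
      have hT : Tendsto (fun n => ENNReal.ofReal (2 * (γ (k n) - 1)) * ((2 * C : ℝ≥0) : ℝ≥0∞))
          atTop (𝓝 0) := by
        have h1 : Tendsto (fun n => 2 * (γ (k n) - 1)) atTop (𝓝 0) := by
          have := (((hγ.mono_right nhdsWithin_le_nhds).comp kmono.tendsto_atTop).sub_const
            1).const_mul 2
          simpa using this
        have h2 := ENNReal.Tendsto.mul_const (b := ((2 * C : ℝ≥0) : ℝ≥0∞))
          (ENNReal.tendsto_ofReal h1) (Or.inr ENNReal.coe_ne_top)
        simpa using h2
      refine (lintegral_liminf_le' fun n => ?_).trans ?_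
      · exact (((wcont _).aemeasurable.pow_const 4).mul
          (((((Θmeas _ 0).aemeasurable.pow_const 2).add
            ((Θmeas _ 1).aemeasurable.pow_const 2)).sub_const 1).pow_const 2)).ennreal_ofReal
      · rw [← hT.liminf_eq]
        exact liminf_le_liminf (Eventually.of_forall fun n => hEpen (k n))
    have hF' : ∫⁻ y in U, ENNReal.ofReal (w₀ y ^ 4 * (u 0 y ^ 2 + u 1 y ^ 2 - 1) ^ 2) = 0 := by
      refine le_antisymm (le_trans (le_of_eq (lintegral_congr_ae ?_)) hF) zero_le
      filter_upwards [hptw] with y hy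
      have h1 := ((wlim y).comp kmono.tendsto_atTop).pow 4
      have h2 := ((((hy 0).pow 2).add ((hy 1).pow 2)).sub_const 1).pow 2
      exact (ENNReal.tendsto_ofReal (h1.mul h2)).liminf_eq.symm
    have hmeas : AEMeasurable (fun y => ENNReal.ofReal (w₀ y ^ 4 *
        (u 0 y ^ 2 + u 1 y ^ 2 - 1) ^ 2)) (volume.restrict U) := by
      have hc : ContinuousOn (fun y => w₀ y ^ 4 * (u 0 y ^ 2 + u 1 y ^ 2 - 1) ^ 2) U :=
        (w0cont.continuousOn.pow 4).mul
          (((((ucont 0).pow 2).add ((ucont 1).pow 2)).sub continuousOn_const).pow 2)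
      exact (hc.aemeasurable hU.measurableSet).ennreal_ofReal
    rw [lintegral_eq_zero_iff' hmeas] at hF'
    filter_upwards [hF', ae_restrict_mem hU.measurableSet] with y hy hyU
    have h1 : w₀ y ^ 4 * (u 0 y ^ 2 + u 1 y ^ 2 - 1) ^ 2 ≤ 0 := ENNReal.ofReal_eq_zero.1 hy
    have h2 : 0 < w₀ y ^ 4 := pow_pos (w0pos y hyU) 4
    have h3 : (u 0 y ^ 2 + u 1 y ^ 2 - 1) ^ 2 ≤ 0 := by
      by_contra hcon
      exact absurd h1 (not_le.2 (mul_pos h2 (not_le.1 hcon)))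
    have h4 := pow_eq_zero_iff (two_ne_zero) |>.1 (le_antisymm h3 (sq_nonneg _))
    linarith
  have hunit : ∀ y ∈ U, u 0 y ^ 2 + u 1 y ^ 2 = 1 := by
    have := Measure.eqOn_open_of_ae_eq (μ := volume) (f := fun y => u 0 y ^ 2 + u 1 y ^ 2)
      (g := fun _ => 1) hunit_ae hU (((ucont 0).pow 2).add ((ucont 1).pow 2)) continuousOn_const
    exact this
  have hH1 : MemH1Loc U fun y => WithLp.toLp 2 fun i => u i y := fun i => ⟨_, uderiv i⟩
  refine ⟨k, fun y => WithLp.toLp 2 fun i => u i y, kmono, hH1, ?_, ?_, ?_, ?_, ?_⟩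
  · intro K hK hKU f hf i
    constructor
    · refine ((hlim i).tendsto_integral_primitive hU hU' h0 (hbl i) hK hKU hf).congr fun n => ?_
      refine integral_congr_ae ?_
      filter_upwards [ae_restrict_of_subset hKU haek] with y hy
      rw [hy n i]
    · have e1 : ∀ n, ∫ y in K, weakDeriv U (fun x => Θs (k n) x i) y * f y
          = ∫ y in K, g (k n) i y * f y := fun n => by
        refine integral_congr_ae ?_
        filter_upwards [ae_restrict_of_subset hKU ((hderiv (k n) i).ae_eq_weakDeriv hU)] with y hy
        rw [hy]
      have e2 : ∫ y in K, weakDeriv U (u i) y * f y = ∫ y in K, G i y / w₀ y * f y := by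
        refine integral_congr_ae ?_
        filter_upwards [ae_restrict_of_subset hKU ((uderiv i).ae_eq_weakDeriv hU)] with y hy
        rw [hy]
      simp only [e1]
      change Tendsto _ _ (𝓝 (∫ y in K, weakDeriv U (u i) y * f y))
      rw [e2]
      exact (hlim i).tendsto_integral hK hKU hf
  · exact (PiLp.continuous_toLp 2 _).comp_continuousOn (continuousOn_pi.2 ucont)
  · intro y hy
    rw [EuclideanSpace.real_norm_sq_eq, Fin.sum_univ_two]
    exact hunit y hy
  · filter_upwards [hptw] with y hy
    exact ((PiLp.continuous_toLp 2 _).tendsto _).comp (tendsto_pi_nhds.2 hy)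
  · set P : ℕ → ℝ≥0∞ := fun n => ∫⁻ y in U,
      ENNReal.ofReal (w n y ^ 4 * Θs n y 0 ^ 2 * Θs n y 1 ^ 2) with hP
    -- `X i n` bounds the gradient energy of component `i` from below and converges to `∫ G²`.
    set X : Fin 2 → ℕ → ℝ := fun i n =>
      2 * (∫ y in U, (w (k n) y * g (k n) i y) * G i y) - ∫ y in U, G i y ^ 2 with hX
    have hsq : ∀ {q : ℝ → ℝ}, MemLp q 2 (volume.restrict U) →
        ∫⁻ y in U, ENNReal.ofReal (q y ^ 2) = ENNReal.ofReal (∫ y in U, q y ^ 2) := fun hq =>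
      (ofReal_integral_eq_lintegral_ofReal hq.integrable_sq (ae_of_all _ fun y => sq_nonneg _)).symm
    have hXP : ∀ n, ENNReal.ofReal (X 0 n + X 1 n) + P (k n) ≤ (2 * C : ℝ≥0) := by
      intro n
      have hle : ∀ i, X i n ≤ ∫ y in U, (w (k n) y * g (k n) i y) ^ 2 := fun i =>
        (hlim i).lower_bound_le n
      have m0 := (hmem (k n) 0).1.integrable_sq.aestronglyMeasurable.aemeasurable.ennreal_ofReal
      have m1 := (hmem (k n) 1).1.integrable_sq.aestronglyMeasurable.aemeasurable.ennreal_ofReal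
      calc ENNReal.ofReal (X 0 n + X 1 n) + P (k n)
          ≤ ENNReal.ofReal ((∫ y in U, (w (k n) y * g (k n) 0 y) ^ 2)
              + ∫ y in U, (w (k n) y * g (k n) 1 y) ^ 2) + P (k n) := by
            gcongr
            exacts [hle 0, hle 1]
        _ = ∫⁻ y in U, (ENNReal.ofReal ((w (k n) y * g (k n) 0 y) ^ 2)
              + (ENNReal.ofReal ((w (k n) y * g (k n) 1 y) ^ 2)
              + ENNReal.ofReal (w (k n) y ^ 4 * Θs (k n) y 0 ^ 2 * Θs (k n) y 1 ^ 2))) := by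
            rw [lintegral_add_left' m0, lintegral_add_left' m1, hsq (hmem _ 0).1,
              hsq (hmem _ 1).1, ENNReal.ofReal_add (integral_nonneg fun y => sq_nonneg _)
              (integral_nonneg fun y => sq_nonneg _), add_assoc]
        _ ≤ _ := by
            refine le_trans (lintegral_mono fun y => ?_) (hE (k n))
            have h2 : 0 ≤ w (k n) y ^ 4 * Θs (k n) y 0 ^ 2 * Θs (k n) y 1 ^ 2 := by positivity
            rw [← ENNReal.ofReal_add (sq_nonneg _) h2, ← ENNReal.ofReal_add (sq_nonneg _)
              (add_nonneg (sq_nonneg _) h2)]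
            refine ENNReal.ofReal_le_ofReal ?_
            have := hpen0 (k n) y
            simp only [mul_pow]
            linarith
    have hXlim : Tendsto (fun n => ENNReal.ofReal (X 0 n + X 1 n)) atTop
        (𝓝 (ENNReal.ofReal ((∫ y in U, G 0 y ^ 2) + ∫ y in U, G 1 y ^ 2))) :=
      ENNReal.tendsto_ofReal ((hlim 0).tendsto_lower_bound.add (hlim 1).tendsto_lower_bound)
    -- The potential is at most the total bound minus the gradient part; Fatou's lemma on the left
    -- and convergence of `X` on the right pass this to the limit.
    have hPle : ∫⁻ y in U, ENNReal.ofReal (w₀ y ^ 4 * u 0 y ^ 2 * u 1 y ^ 2) ≤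
        ((2 * C : ℝ≥0) : ℝ≥0∞)
          - ENNReal.ofReal ((∫ y in U, G 0 y ^ 2) + ∫ y in U, G 1 y ^ 2) := by
      have hsub := ENNReal.Tendsto.sub (tendsto_const_nhds (x := ((2 * C : ℝ≥0) : ℝ≥0∞)))
        hXlim (Or.inl ENNReal.coe_ne_top)
      calc ∫⁻ y in U, ENNReal.ofReal (w₀ y ^ 4 * u 0 y ^ 2 * u 1 y ^ 2)
          = ∫⁻ y in U, liminf (fun n => ENNReal.ofReal
              (w (k n) y ^ 4 * Θs (k n) y 0 ^ 2 * Θs (k n) y 1 ^ 2)) atTop := by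
            refine lintegral_congr_ae ?_
            filter_upwards [hptw] with y hy
            have h1 := ((wlim y).comp kmono.tendsto_atTop).pow 4
            exact (ENNReal.tendsto_ofReal
              ((h1.mul ((hy 0).pow 2)).mul ((hy 1).pow 2))).liminf_eq.symm
        _ ≤ liminf (fun n => P (k n)) atTop := lintegral_liminf_le' fun n =>
            ((((wcont _).aemeasurable.pow_const 4).mul
              ((Θmeas _ 0).aemeasurable.pow_const 2)).mul
              ((Θmeas _ 1).aemeasurable.pow_const 2)).ennreal_ofReal
        _ ≤ liminf (fun n => ((2 * C : ℝ≥0) : ℝ≥0∞) - ENNReal.ofReal (X 0 n + X 1 n)) atTop :=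
            liminf_le_liminf (Eventually.of_forall fun n =>
              ENNReal.le_sub_of_add_le_left ENNReal.ofReal_ne_top (hXP n))
        _ = _ := hsub.liminf_eq
    -- Subtraction in `ℝ≥0∞` truncates at zero; this inequality lets it be undone when the two parts
    -- are added.
    have hSle : ENNReal.ofReal ((∫ y in U, G 0 y ^ 2) + ∫ y in U, G 1 y ^ 2)
        ≤ ((2 * C : ℝ≥0) : ℝ≥0∞) :=
      le_of_tendsto' hXlim fun n => le_self_add.trans (hXP n)
    have htotal : ∫⁻ y in U, ENNReal.ofReal (w₀ y ^ 2 * weakDeriv U (u 0) y ^ 2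
        + w₀ y ^ 2 * weakDeriv U (u 1) y ^ 2 + w₀ y ^ 4 * u 0 y ^ 2 * u 1 y ^ 2)
        ≤ ((2 * C : ℝ≥0) : ℝ≥0∞) := by
      have m0 := (hlim 0).memLp_limit.integrable_sq.aestronglyMeasurable.aemeasurable.ennreal_ofReal
      have m1 := (hlim 1).memLp_limit.integrable_sq.aestronglyMeasurable.aemeasurable.ennreal_ofReal
      calc _ = ∫⁻ y in U, (ENNReal.ofReal (G 0 y ^ 2) + (ENNReal.ofReal (G 1 y ^ 2)
              + ENNReal.ofReal (w₀ y ^ 4 * u 0 y ^ 2 * u 1 y ^ 2))) := by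
            refine lintegral_congr_ae ?_
            filter_upwards [(uderiv 0).ae_eq_weakDeriv hU, (uderiv 1).ae_eq_weakDeriv hU,
              ae_restrict_mem hU.measurableSet] with y h1 h2 hyU
            have h3 : 0 ≤ w₀ y ^ 4 * u 0 y ^ 2 * u 1 y ^ 2 := by positivity
            have h4 := (w0pos y hyU).ne'
            rw [h1, h2, ← ENNReal.ofReal_add (sq_nonneg _) h3, ← ENNReal.ofReal_add (sq_nonneg _)
              (add_nonneg (sq_nonneg _) h3)]
            congr 1
            field_simp
            ring
        _ = ENNReal.ofReal ((∫ y in U, G 0 y ^ 2) + ∫ y in U, G 1 y ^ 2)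
              + ∫⁻ y in U, ENNReal.ofReal (w₀ y ^ 4 * u 0 y ^ 2 * u 1 y ^ 2) := by
            rw [lintegral_add_left' m0, lintegral_add_left' m1, hsq (hlim 0).memLp_limit,
              hsq (hlim 1).memLp_limit, ENNReal.ofReal_add (integral_nonneg fun y => sq_nonneg _)
              (integral_nonneg fun y => sq_nonneg _), add_assoc]
        _ ≤ _ := (add_le_add_right hPle _).trans (add_tsub_cancel_of_le hSle).le
    have hnorm : ∀ᵐ y ∂(volume.restrict U), u 0 y ^ 2 + u 1 y ^ 2 = 1 := hunit_ae
    unfold limitEnergy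
    rw [if_pos ⟨hH1, hnorm⟩]
    calc _ ≤ 1 / 2 * ((2 * C : ℝ≥0) : ℝ≥0∞) := mul_le_mul_right htotal _
      _ = C := by
        rw [ENNReal.coe_mul, ← mul_assoc, one_div, ENNReal.coe_ofNat,
          ENNReal.inv_mul_cancel (by norm_num) (by norm_num), one_mul]

/-- The limit energy only depends on the profile up to null sets of the cloud. -/
theorem limitEnergy_congr {μ : ℝ} {Θ Θ' : Profile} (h : MemH1Loc (cloudInterval μ) Θ)
    (he : Θ =ᵐ[volume.restrict (cloudInterval μ)] Θ') : limitEnergy μ Θ' = limitEnergy μ Θ := by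
  have hU : IsOpen (cloudInterval μ) := isOpen_Ioo
  have hi : ∀ i, (fun y => Θ y i) =ᵐ[volume.restrict (cloudInterval μ)] fun y => Θ' y i :=
    fun i => he.mono fun y hy => by simp only [hy]
  have hw : ∀ i, HasWeakDerivOn (cloudInterval μ) (fun y => Θ' y i)
      (weakDeriv (cloudInterval μ) fun y => Θ y i) :=
    fun i => (weakDeriv_spec (h i)).congr (hi i) EventuallyEq.rfl
  have h' : MemH1Loc (cloudInterval μ) Θ' := fun i => ⟨_, hw i⟩
  have hiff : (∀ᵐ y ∂(volume.restrict (cloudInterval μ)), Θ' y 0 ^ 2 + Θ' y 1 ^ 2 = 1) ↔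
      ∀ᵐ y ∂(volume.restrict (cloudInterval μ)), Θ y 0 ^ 2 + Θ y 1 ^ 2 = 1 := by
    refine eventually_congr ?_
    filter_upwards [he] with y hy
    rw [hy]
  unfold limitEnergy
  by_cases hc : ∀ᵐ y ∂(volume.restrict (cloudInterval μ)), Θ y 0 ^ 2 + Θ y 1 ^ 2 = 1
  · rw [if_pos ⟨h', hiff.2 hc⟩, if_pos ⟨h, hc⟩]
    congr 1
    refine lintegral_congr_ae ?_
    filter_upwards [he, (hw 0).ae_eq_weakDeriv hU, (hw 1).ae_eq_weakDeriv hU] with y h1 h2 h3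
    rw [h1, h2, h3]
  · rw [if_neg fun q => hc (hiff.1 q.2), if_neg fun q => hc q.2]

/-- On compact intervals `L²` convergence implies convergence in measure, hence almost everywhere
along a subsequence, and pointwise limits are unique. -/
theorem ae_eq_of_tendstoL2Loc {U : Set ℝ} (hU' : U.OrdConnected)
    {Θs : ℕ → Profile} {Θ Θ' : Profile}
    (hm : ∀ n i, MemL2Loc U fun y => Θs n y i) (hΘ : MemL2Loc U Θ)
    (h : TendstoL2Loc U Θs atTop Θ)
    (h' : ∀ᵐ y ∂(volume.restrict U), Tendsto (fun n => Θs n y) atTop (𝓝 (Θ' y))) :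
    Θ' =ᵐ[volume.restrict U] Θ := by
  refine ae_restrict_of_ae_restrict_inter_Ioo fun a b ha hb hab => ?_
  have hI : Set.Icc a b ⊆ U := hU'.out ha hb
  refine ae_restrict_of_subset (Set.inter_subset_right.trans Set.Ioo_subset_Icc_self) ?_
  have hmeas : ∀ n, AEStronglyMeasurable (Θs n) (volume.restrict (Set.Icc a b)) := fun n => by
    have h1 : AEMeasurable (fun y i => Θs n y i) (volume.restrict (Set.Icc a b)) :=
      aemeasurable_pi_lambda _ fun i =>
        (hm n i _ isCompact_Icc hI).aestronglyMeasurable.aemeasurable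
    exact ((PiLp.continuous_toLp 2 _).measurable.comp_aemeasurable h1).aestronglyMeasurable
  have hin : TendstoInMeasure (volume.restrict (Set.Icc a b)) Θs atTop Θ :=
    tendstoInMeasure_of_tendsto_eLpNorm two_ne_zero hmeas
      (hΘ _ isCompact_Icc hI).aestronglyMeasurable (h _ isCompact_Icc hI)
  obtain ⟨ns, hns, hlim⟩ := hin.exists_seq_tendsto_ae
  filter_upwards [hlim, ae_restrict_of_subset hI h'] with y h1 h2
  exact tendsto_nhds_unique (h2.comp hns.tendsto_atTop) h1

/-- Compactness for sequences that are eventually of bounded energy. -/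
theorem exists_weak_limit {η : ℝ → ℝ → ℝ}
    (hη : ∀ ε : ℝ, 0 < ε → ε < 1 → IsGroundState ε (η ε)) {μ : ℝ} (hμ : 0 < μ)
    {γ : ℕ → ℝ} {Θs : ℕ → Profile} (hγ : Tendsto γ atTop (𝓝[>] 1))
    (hΘ : ∀ n, MemH1Loc Set.univ (Θs n)) {C : ℝ≥0}
    (hC : ∀ᶠ n in atTop, energy η μ (γ n) (Θs n) ≤ C) :
    ∃ (k : ℕ → ℕ) (Θ : Profile), StrictMono k ∧ MemH1Loc (cloudInterval μ) Θ ∧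
      TendstoWeaklyH1Loc (cloudInterval μ) (fun n => Θs (k n)) atTop Θ ∧
      ContinuousOn Θ (cloudInterval μ) ∧ (∀ y ∈ cloudInterval μ, ‖Θ y‖ ^ 2 = 1) ∧
      (∀ᵐ y ∂(volume.restrict (cloudInterval μ)),
        Tendsto (fun n => Θs (k n) y) atTop (𝓝 (Θ y))) ∧
      limitEnergy μ Θ ≤ C := by
  -- Dropping the first `N` terms turns eventual bounds into bounds for every index.
  obtain ⟨N, hN⟩ := eventually_atTop.1 (hC.and (hγ.eventually (tendsto_ground_parameter hμ).2))
  obtain ⟨k, Θ, hk, h⟩ := exists_limit_profile hη hμ (γ := fun n => γ (n + N))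
    (Θs := fun n => Θs (n + N)) (hγ.comp (tendsto_add_atTop_nat N))
    (fun n => (hN _ (by omega)).2) (fun n => hΘ _) (fun n => (hN _ (by omega)).1)
  exact ⟨fun n => k n + N, Θ, fun m n hmn => by simpa using hk hmn, h⟩

/-- The lower semicontinuity inequality. -/
theorem limitEnergy_le_liminf {η : ℝ → ℝ → ℝ}
    (hη : ∀ ε : ℝ, 0 < ε → ε < 1 → IsGroundState ε (η ε)) {μ : ℝ} (hμ : 0 < μ)
    {γ : ℕ → ℝ} {Θs : ℕ → Profile} {Θ : Profile} (hγ : Tendsto γ atTop (𝓝[>] 1))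
    (hΘs : ∀ n, MemH1Loc Set.univ (Θs n)) (hΘ : MemL2Loc (cloudInterval μ) Θ)
    (hlim : TendstoL2Loc (cloudInterval μ) Θs atTop Θ) :
    limitEnergy μ Θ ≤ liminf (fun n => energy η μ (γ n) (Θs n)) atTop := by
  -- It suffices to bound the limit energy by each `c` above the liminf; for such `c` the energy
  -- lies below `c` along a subsequence, to which compactness applies.
  refine le_of_forall_gt_imp_ge_of_dense fun c hc => ?_
  rcases eq_or_ne c ⊤ with rfl | hctop
  · exact le_top
  lift c to ℝ≥0 using hctop
  obtain ⟨φ, hφ, hlt⟩ := extraction_of_frequently_atTop (frequently_lt_of_liminf_lt (h := hc))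
  obtain ⟨k, Θ', hk, hH, -, -, -, hae, hle⟩ := exists_weak_limit hη hμ
    (Θs := fun n => Θs (φ n)) (hγ.comp hφ.tendsto_atTop) (fun n => hΘs _)
    (Eventually.of_forall fun n => (hlt n).le)
  have hkφ : Tendsto (fun n => φ (k n)) atTop atTop := hφ.tendsto_atTop.comp hk.tendsto_atTop
  have he := ae_eq_of_tendstoL2Loc Set.ordConnected_Ioo (Θs := fun n => Θs (φ (k n)))
    (fun n i => (weakDeriv_spec (hΘs (φ (k n)) i)).memL2Loc.mono (Set.subset_univ _)) hΘ
    (fun K hK hKU => (hlim K hK hKU).comp hkφ) hae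
  rwa [limitEnergy_congr hH he]

/-! ### Recovery sequences -/

/-- `N i` is the largest `m ≤ b i` for which `p j i` holds for all `j ≤ m`. The cap `b` makes this
maximum exist, and its divergence lets `N` diverge. -/
theorem exists_diagonal {ι : Type*} {l : Filter ι} {b : ι → ℕ} (hb : Tendsto b l atTop)
    {p : ℕ → ι → Prop} (hp : ∀ m, ∀ᶠ i in l, p m i) :
    ∃ N : ι → ℕ, Tendsto N l atTop ∧ ∀ᶠ i in l, p (N i) i := by
  classical
  have hall : ∀ m, ∀ᶠ i in l, ∀ j ≤ m, p j i := fun m =>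
    (Set.finite_Iic m).eventually_all.2 fun j _ => hp j
  refine ⟨fun i => Nat.findGreatest (fun m => ∀ j ≤ m, p j i) (b i), ?_, ?_⟩
  · refine tendsto_atTop.2 fun M => ?_
    filter_upwards [hall M, hb.eventually_ge_atTop M] with i h1 h2
    exact Nat.le_findGreatest h2 h1
  · filter_upwards [hall 0] with i hi
    exact Nat.findGreatest_spec (P := fun m => ∀ j ≤ m, p j i) (Nat.zero_le _) hi _ le_rfl

/-- The primitive of the derivative `g` cut off outside `(-r, r]`. -/
noncomputable def truncatedProfile (a : Fin 2 → ℝ) (g : Fin 2 → ℝ → ℝ) (r : ℝ) : Profile :=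
  fun y => WithLp.toLp 2 fun i => a i + ∫ t in (0 : ℝ)..y, (Set.Ioc (-r) r).indicator (g i) t

variable {μ r : ℝ} {a : Fin 2 → ℝ} {g : Fin 2 → ℝ → ℝ}

theorem Icc_subset_cloudInterval (hr : r < 1 / μ) : Set.Icc (-r) r ⊆ cloudInterval μ :=
  fun _ hy => ⟨by linarith [hy.1], by linarith [hy.2]⟩

theorem memLp_truncated (hr : r < 1 / μ) {q : ℝ → ℝ} (hq : MemL2Loc (cloudInterval μ) q) :
    MemLp ((Set.Ioc (-r) r).indicator q) 2 volume :=
  (memLp_indicator_iff_restrict measurableSet_Ioc).2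
    ((hq _ isCompact_Icc (Icc_subset_cloudInterval hr)).mono_measure
      (Measure.restrict_mono Set.Ioc_subset_Icc_self le_rfl))

theorem hasWeakDerivOn_truncatedProfile (hr : r < 1 / μ)
    (hg : ∀ i, MemL2Loc (cloudInterval μ) (g i)) (i : Fin 2) :
    HasWeakDerivOn Set.univ (fun y => truncatedProfile a g r y i)
      ((Set.Ioc (-r) r).indicator (g i)) :=
  hasWeakDerivOn_primitive isOpen_univ Set.ordConnected_univ (Set.mem_univ _)
    (fun _ _ _ => (memLp_truncated hr (hg i)).mono_measure Measure.restrict_le_self) (a i)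

theorem continuous_truncatedProfile (hr : r < 1 / μ)
    (hg : ∀ i, MemL2Loc (cloudInterval μ) (g i)) (i : Fin 2) :
    Continuous fun y => truncatedProfile a g r y i :=
  continuousOn_univ.1 (continuousOn_primitive isOpen_univ Set.ordConnected_univ (Set.mem_univ _)
    (fun _ _ _ => (memLp_truncated hr (hg i)).mono_measure Measure.restrict_le_self) (a i))

theorem truncatedProfile_apply_of_mem {y : ℝ} (hr : 0 < r) (hy : y ∈ Set.Icc (-r) r) (i : Fin 2) :
    truncatedProfile a g r y i = a i + ∫ t in (0 : ℝ)..y, g i t := by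
  simp only [truncatedProfile]
  congr 1
  refine intervalIntegral.integral_congr_ae (ae_of_all _ fun t ht => ?_)
  rw [Set.indicator_of_mem]
  rcases Set.mem_uIoc.1 ht with h | h
  · exact ⟨by linarith [h.1], by linarith [h.2, hy.2]⟩
  · exact ⟨by linarith [h.1, hy.1], by linarith [h.2]⟩

/-- The truncated profile is frozen beyond `±r`, so `z` is `y` clamped to `[-r, r]`. Any pointwise
constraint, in particular unit length, is therefore inherited on the whole line. -/
theorem exists_truncatedProfile_eq (hr0 : 0 < r) (hr : r < 1 / μ)
    (hg : ∀ i, MemL2Loc (cloudInterval μ) (g i)) (y : ℝ) :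
    ∃ z ∈ Set.Icc (-r) r, ∀ i, truncatedProfile a g r y i = a i + ∫ t in (0 : ℝ)..z, g i t := by
  have hint : ∀ i b c, IntervalIntegrable ((Set.Ioc (-r) r).indicator (g i)) volume b c :=
    fun i b c => MemL2Loc.intervalIntegrable (U := Set.univ)
      (fun _ _ _ => (memLp_truncated hr (hg i)).mono_measure Measure.restrict_le_self)
      Set.ordConnected_univ (Set.mem_univ _) (Set.mem_univ _)
  have key : ∀ z ∈ Set.Icc (-r) r, (∀ t ∈ Set.uIoc z y, t ∉ Set.Ioc (-r) r) →
      ∀ i, truncatedProfile a g r y i = a i + ∫ t in (0 : ℝ)..z, g i t := by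
    intro z hz hzy i
    rw [← truncatedProfile_apply_of_mem hr0 hz]
    simp only [truncatedProfile]
    rw [← intervalIntegral.integral_add_adjacent_intervals (hint i 0 z) (hint i z y)]
    have : ∫ t in z..y, (Set.Ioc (-r) r).indicator (g i) t = ∫ _ in z..y, (0 : ℝ) :=
      intervalIntegral.integral_congr_ae (ae_of_all _ fun t ht =>
        Set.indicator_of_notMem (hzy t ht) _)
    rw [this]
    simp
  rcases lt_or_ge y (-r) with h1 | h1
  · refine ⟨-r, ⟨le_rfl, by linarith⟩, key _ ⟨le_rfl, by linarith⟩ fun t ht hm => ?_⟩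
    rw [Set.uIoc_of_ge h1.le] at ht
    linarith [ht.2, hm.1]
  rcases lt_or_ge r y with h2 | h2
  · refine ⟨r, ⟨by linarith, le_rfl⟩, key _ ⟨by linarith, le_rfl⟩ fun t ht hm => ?_⟩
    rw [Set.uIoc_of_le h2.le] at ht
    linarith [ht.1, hm.2]
  · exact ⟨y, ⟨h1, h2⟩, fun i => truncatedProfile_apply_of_mem hr0 ⟨h1, h2⟩ i⟩

theorem cloud_weight_eq_zero (hμ : 0 < μ) {y : ℝ} (hy : y ∉ cloudInterval μ) :
    thomasFermi (μ * y) = 0 := by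
  unfold thomasFermi
  refine Set.indicator_of_notMem (fun h => hy ?_) _
  have h' : |μ * y| < 1 := h
  rw [abs_mul, abs_of_pos hμ, mul_comm, ← lt_div_iff₀ hμ] at h'
  exact abs_lt.1 h'

/-- For a fixed truncation of a unit profile the energies converge. -/
theorem tendsto_energy_truncatedProfile {η : ℝ → ℝ → ℝ}
    (hη : ∀ ε : ℝ, 0 < ε → ε < 1 → IsGroundState ε (η ε)) (hμ : 0 < μ) (hr : r < 1 / μ)
    (hg : ∀ i, MemL2Loc (cloudInterval μ) (g i))
    (hunit : ∀ y, truncatedProfile a g r y 0 ^ 2 + truncatedProfile a g r y 1 ^ 2 = 1) :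
    Tendsto (fun γ => energy η μ γ (truncatedProfile a g r)) (𝓝[>] 1)
      (𝓝 (1 / 2 * ∫⁻ y : ℝ, ENNReal.ofReal (
        thomasFermi (μ * y) ^ 2 * (Set.Ioc (-r) r).indicator (g 0) y ^ 2
        + thomasFermi (μ * y) ^ 2 * (Set.Ioc (-r) r).indicator (g 1) y ^ 2
        + thomasFermi (μ * y) ^ 4 * truncatedProfile a g r y 0 ^ 2
          * truncatedProfile a g r y 1 ^ 2))) := by
  set T := truncatedProfile a g r with hT
  set G : Fin 2 → ℝ → ℝ := fun i => (Set.Ioc (-r) r).indicator (g i) with hG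
  have hGm : ∀ i, MemLp (G i) 2 volume := fun i => memLp_truncated hr (hg i)
  obtain ⟨hlim, hev⟩ := tendsto_ground_parameter hμ
  have hgs : ∀ᶠ γ in 𝓝[>] (1 : ℝ), IsGroundState (μ * √(γ - 1)) (η (μ * √(γ - 1))) :=
    hev.mono fun γ h => hη _ h.2.1 h.2.2
  have hwd : ∀ i, weakDeriv Set.univ (fun x => T x i) =ᵐ[volume] G i := fun i => by
    have := (hasWeakDerivOn_truncatedProfile (a := a) hr hg i).ae_eq_weakDeriv isOpen_univ
    rwa [Measure.restrict_univ] at this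
  -- Unit length everywhere removes the penalty, the only term with a singular prefactor.
  have hcong : ∀ γ, energy η μ γ T = 1 / 2 * ∫⁻ y : ℝ, ENNReal.ofReal (
      η (μ * √(γ - 1)) (μ * y) ^ 2 * G 0 y ^ 2 + η (μ * √(γ - 1)) (μ * y) ^ 2 * G 1 y ^ 2
      + η (μ * √(γ - 1)) (μ * y) ^ 4 * T y 0 ^ 2 * T y 1 ^ 2) := by
    intro γ
    unfold energy
    congr 1
    refine lintegral_congr_ae ?_
    filter_upwards [hwd 0, hwd 1] with y h0 h1
    rw [h0, h1, hunit y, sub_self]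
    congr 1
    ring
  simp only [hcong]
  refine ENNReal.Tendsto.const_mul ?_ (Or.inr (by norm_num))
  -- The gradient terms are dominated using `η ≤ 1`, and the potential by the uniform decay of `η⁴`,
  -- because `T` does not decay at infinity.
  refine tendsto_lintegral_filter_of_dominated_convergence'
    (fun y => ENNReal.ofReal (G 0 y ^ 2 + G 1 y ^ 2 + 64 * (1 + (μ * y) ^ 2)⁻¹)) ?_ ?_ ?_ ?_
  · filter_upwards [hgs] with γ hγ
    have hc : Continuous fun y => η (μ * √(γ - 1)) (μ * y) := hγ.continuous.comp (by fun_prop)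
    have m0 := (hGm 0).aestronglyMeasurable.aemeasurable
    have m1 := (hGm 1).aestronglyMeasurable.aemeasurable
    have t0 := (continuous_truncatedProfile (a := a) hr hg 0).aemeasurable (μ := volume)
    have t1 := (continuous_truncatedProfile (a := a) hr hg 1).aemeasurable (μ := volume)
    exact ((((hc.aemeasurable.pow_const 2).mul (m0.pow_const 2)).add
      ((hc.aemeasurable.pow_const 2).mul (m1.pow_const 2))).add
      (((hc.aemeasurable.pow_const 4).mul (t0.pow_const 2)).mul (t1.pow_const 2))).ennreal_ofReal
  · filter_upwards [hgs, hev] with γ hγ hγ'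
    refine ae_of_all _ fun y => ENNReal.ofReal_le_ofReal ?_
    have h1 : η (μ * √(γ - 1)) (μ * y) ^ 2 ≤ 1 :=
      pow_le_one₀ (hγ.pos _).le (hγ.le_one _)
    have h2 := hγ.pow_four_le hγ'.2.1 hγ'.2.2 (μ * y)
    rw [div_eq_mul_inv] at h2
    have h3 : T y 0 ^ 2 * T y 1 ^ 2 ≤ 1 := by
      have := hunit y
      nlinarith [sq_nonneg (T y 0), sq_nonneg (T y 1), sq_nonneg (T y 0 ^ 2 - T y 1 ^ 2)]
    have h4 : η (μ * √(γ - 1)) (μ * y) ^ 4 * (T y 0 ^ 2 * T y 1 ^ 2)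
        ≤ η (μ * √(γ - 1)) (μ * y) ^ 4 :=
      mul_le_of_le_one_right (by positivity) h3
    have h5 := mul_le_of_le_one_left (sq_nonneg (G 0 y)) h1
    have h6 := mul_le_of_le_one_left (sq_nonneg (G 1 y)) h1
    rw [← mul_assoc] at h4
    linarith
  · have hi : Integrable fun y : ℝ => G 0 y ^ 2 + G 1 y ^ 2 + 64 * (1 + (μ * y) ^ 2)⁻¹ :=
      ((hGm 0).integrable_sq.add (hGm 1).integrable_sq).add
        ((integrable_inv_one_add_sq.comp_mul_left' hμ.ne').const_mul 64)
    exact (hi.lintegral_lt_top).ne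
  · refine ae_of_all _ fun y => ENNReal.tendsto_ofReal ?_
    have h := tendsto_groundState hlim hgs (μ * y)
    exact (((h.pow 2).mul_const _).add ((h.pow 2).mul_const _)).add
      (((h.pow 4).mul_const _).mul_const _)

/-- The limit energy of a truncation exceeds that of the profile by at most the length cut off. -/
theorem truncated_limit_le (hμ : 0 < μ) (hr0 : 0 < r) (hr : r < 1 / μ)
    (hunit : ∀ y, truncatedProfile a g r y 0 ^ 2 + truncatedProfile a g r y 1 ^ 2 = 1) :
    1 / 2 * ∫⁻ y : ℝ, ENNReal.ofReal (
        thomasFermi (μ * y) ^ 2 * (Set.Ioc (-r) r).indicator (g 0) y ^ 2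
        + thomasFermi (μ * y) ^ 2 * (Set.Ioc (-r) r).indicator (g 1) y ^ 2
        + thomasFermi (μ * y) ^ 4 * truncatedProfile a g r y 0 ^ 2
          * truncatedProfile a g r y 1 ^ 2) ≤
      1 / 2 * (∫⁻ y in cloudInterval μ, ENNReal.ofReal (
        thomasFermi (μ * y) ^ 2 * g 0 y ^ 2 + thomasFermi (μ * y) ^ 2 * g 1 y ^ 2
        + thomasFermi (μ * y) ^ 4 * (a 0 + ∫ t in (0 : ℝ)..y, g 0 t) ^ 2
          * (a 1 + ∫ t in (0 : ℝ)..y, g 1 t) ^ 2)) + ENNReal.ofReal (1 / μ - r) := by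
  have hUm : MeasurableSet (cloudInterval μ) := measurableSet_Ioo
  set A : ℝ → ℝ≥0∞ := fun y => ENNReal.ofReal (
        thomasFermi (μ * y) ^ 2 * g 0 y ^ 2 + thomasFermi (μ * y) ^ 2 * g 1 y ^ 2
        + thomasFermi (μ * y) ^ 4 * (a 0 + ∫ t in (0 : ℝ)..y, g 0 t) ^ 2
          * (a 1 + ∫ t in (0 : ℝ)..y, g 1 t) ^ 2) with hA
  set S := cloudInterval μ \ Set.Ioc (-r) r with hS
  have hSm : MeasurableSet S := hUm.diff measurableSet_Ioc
  have hsub : Set.Ioc (-r) r ⊆ cloudInterval μ :=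
    Set.Ioc_subset_Icc_self.trans (Icc_subset_cloudInterval hr)
  -- Two end pieces of length `1/μ - r`; the prefactor `1/2` of the energy turns this into the
  -- stated error.
  have hvol : volume S = ENNReal.ofReal (2 * (1 / μ - r)) := by
    rw [hS, measure_sdiff hsub measurableSet_Ioc.nullMeasurableSet (by simp), cloudInterval,
      Real.volume_Ioo, Real.volume_Ioc, ← ENNReal.ofReal_sub _ (by linarith)]
    congr 1
    ring
  have hpt : ∀ y, ENNReal.ofReal (
        thomasFermi (μ * y) ^ 2 * (Set.Ioc (-r) r).indicator (g 0) y ^ 2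
        + thomasFermi (μ * y) ^ 2 * (Set.Ioc (-r) r).indicator (g 1) y ^ 2
        + thomasFermi (μ * y) ^ 4 * truncatedProfile a g r y 0 ^ 2
          * truncatedProfile a g r y 1 ^ 2)
      ≤ (cloudInterval μ).indicator A y + S.indicator 1 y := by
    intro y
    by_cases hyU : y ∈ cloudInterval μ
    · by_cases hyr : y ∈ Set.Ioc (-r) r
      · rw [Set.indicator_of_mem hyr, Set.indicator_of_mem hyr, Set.indicator_of_mem hyU,
          truncatedProfile_apply_of_mem hr0 (Set.Ioc_subset_Icc_self hyr),
          truncatedProfile_apply_of_mem hr0 (Set.Ioc_subset_Icc_self hyr)]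
        exact le_self_add
      -- On the end pieces the derivative is cut off, leaving the potential density, which is at
      -- most `1`.
      · rw [Set.indicator_of_notMem hyr, Set.indicator_of_notMem hyr,
          Set.indicator_of_mem (show y ∈ S from ⟨hyU, hyr⟩)]
        refine le_trans ?_ le_add_self
        rw [Pi.one_apply, ENNReal.ofReal_le_one]
        have h1 : thomasFermi (μ * y) ^ 4 ≤ 1 :=
          pow_le_one₀ (thomasFermi_nonneg _) (thomasFermi_le_one _)
        have h2 : truncatedProfile a g r y 0 ^ 2 * truncatedProfile a g r y 1 ^ 2 ≤ 1 := by
          have := hunit y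
          nlinarith [sq_nonneg (truncatedProfile a g r y 0),
            sq_nonneg (truncatedProfile a g r y 1),
            sq_nonneg (truncatedProfile a g r y 0 ^ 2 - truncatedProfile a g r y 1 ^ 2)]
        have h3 := mul_le_one₀ h1 (by positivity) h2
        rw [← mul_assoc] at h3
        simpa using h3
    · rw [cloud_weight_eq_zero hμ hyU]
      simp
  calc _ ≤ 1 / 2 * ∫⁻ y, ((cloudInterval μ).indicator A y + S.indicator 1 y) := by
        gcongr with y
        exact hpt y
    _ = 1 / 2 * ((∫⁻ y in cloudInterval μ, A y) + ENNReal.ofReal (2 * (1 / μ - r))) := by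
        rw [lintegral_add_right _ (measurable_one.indicator hSm), lintegral_indicator hUm,
          lintegral_indicator_one hSm, hvol]
    _ = _ := by
        rw [mul_add, ENNReal.ofReal_mul (by norm_num), ← mul_assoc (1 / 2) (ENNReal.ofReal 2),
          ENNReal.ofReal_ofNat, one_div, ENNReal.inv_mul_cancel (by norm_num) (by norm_num),
          one_mul]

/-- Existence of recovery sequences. -/
theorem exists_recovery {η : ℝ → ℝ → ℝ}
    (hη : ∀ ε : ℝ, 0 < ε → ε < 1 → IsGroundState ε (η ε)) (hμ : 0 < μ) {Θ : Profile}
    (hΘ : MemH1Loc (cloudInterval μ) Θ) :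
    ∃ Θs : ℝ → Profile, (∀ γ, 1 < γ → MemH1Loc Set.univ (Θs γ)) ∧
      TendstoL2Loc (cloudInterval μ) Θs (𝓝[>] 1) Θ ∧
      limsup (fun γ => energy η μ γ (Θs γ)) (𝓝[>] 1) ≤ limitEnergy μ Θ := by
  set U := cloudInterval μ with hUdef
  have hU : IsOpen U := isOpen_Ioo
  have hU' : U.OrdConnected := Set.ordConnected_Ioo
  have h0 : (0 : ℝ) ∈ U := zero_mem_cloudInterval hμ
  set g : Fin 2 → ℝ → ℝ := fun i => weakDeriv U fun x => Θ x i with hgdef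
  have hd : ∀ i, HasWeakDerivOn U (fun y => Θ y i) (g i) := fun i => weakDeriv_spec (hΘ i)
  have hg : ∀ i, MemL2Loc U (g i) := fun i => (hd i).memL2Loc_deriv
  choose a ha using fun i => (hd i).exists_ae_eq_primitive hU hU' h0
  have hae : ∀ᵐ y ∂(volume.restrict U), ∀ i, Θ y i = a i + ∫ t in (0 : ℝ)..y, g i t :=
    ae_all_iff.2 ha
  have hR : 0 < 1 / μ := by positivity
  -- The shift by `2` keeps `ρ 0` positive.
  set ρ : ℕ → ℝ := fun m => 1 / μ - 1 / μ / (m + 2) with hρ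
  have hρ1 : ∀ m, ρ m < 1 / μ := fun m => by
    have : 0 < 1 / μ / (m + 2) := by positivity
    simp only [hρ]
    linarith
  have hρ0 : ∀ m, 0 < ρ m := fun m => by
    have h2 : (1 : ℝ) < m + 2 := by linarith [m.cast_nonneg (α := ℝ)]
    have := div_lt_self hR h2
    simp only [hρ]
    linarith
  have he : Tendsto (fun m : ℕ => 1 / μ / ((m : ℝ) + 2)) atTop (𝓝 0) :=
    tendsto_const_nhds.div_atTop (tendsto_atTop_add_const_right _ _ tendsto_natCast_atTop_atTop)
  have hρlim : Tendsto ρ atTop (𝓝 (1 / μ)) := by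
    have := he.const_sub (1 / μ)
    rwa [sub_zero] at this
  -- The truncation costs at most `1/μ/(m+2)`; doubling it leaves a strict gap, so convergence of
  -- the energies gives the bound for `γ` near `1`. If the limit energy is infinite there is nothing
  -- to show.
  have hev : ∀ m, ∀ᶠ γ in 𝓝[>] (1 : ℝ), energy η μ γ (truncatedProfile a g (ρ m))
      ≤ limitEnergy μ Θ + ENNReal.ofReal (2 * (1 / μ / (m + 2))) := by
    intro m
    rcases eq_or_ne (limitEnergy μ Θ) ⊤ with htop | hfin
    · simp [htop]
    have hcond : MemH1Loc U Θ ∧ ∀ᵐ y ∂(volume.restrict U), Θ y 0 ^ 2 + Θ y 1 ^ 2 = 1 := by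
      by_contra hc
      exact hfin (if_neg hc)
    have ucont : ∀ i, ContinuousOn (fun y => a i + ∫ t in (0 : ℝ)..y, g i t) U := fun i =>
      continuousOn_primitive hU hU' h0 (hg i) (a i)
    have hone : ∀ y ∈ U, (a 0 + ∫ t in (0 : ℝ)..y, g 0 t) ^ 2
        + (a 1 + ∫ t in (0 : ℝ)..y, g 1 t) ^ 2 = 1 := by
      refine Measure.eqOn_open_of_ae_eq (μ := volume) (f := fun y =>
        (a 0 + ∫ t in (0 : ℝ)..y, g 0 t) ^ 2 + (a 1 + ∫ t in (0 : ℝ)..y, g 1 t) ^ 2)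
        (g := fun _ => 1) ?_ hU (((ucont 0).pow 2).add ((ucont 1).pow 2)) continuousOn_const
      filter_upwards [hae, hcond.2] with y h1 h2
      rw [← h1 0, ← h1 1, h2]
    have hunit : ∀ y, truncatedProfile a g (ρ m) y 0 ^ 2
        + truncatedProfile a g (ρ m) y 1 ^ 2 = 1 := by
      intro y
      obtain ⟨z, hz, hzy⟩ := exists_truncatedProfile_eq (a := a) (hρ0 m) (hρ1 m) hg y
      rw [hzy 0, hzy 1]
      exact hone z (Icc_subset_cloudInterval (hρ1 m) hz)
    have hle := truncated_limit_le hμ (hρ0 m) (hρ1 m) hunit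
    have hE : limitEnergy μ Θ = 1 / 2 * ∫⁻ y in U, ENNReal.ofReal (
        thomasFermi (μ * y) ^ 2 * g 0 y ^ 2 + thomasFermi (μ * y) ^ 2 * g 1 y ^ 2
        + thomasFermi (μ * y) ^ 4 * (a 0 + ∫ t in (0 : ℝ)..y, g 0 t) ^ 2
          * (a 1 + ∫ t in (0 : ℝ)..y, g 1 t) ^ 2) := by
      unfold limitEnergy
      rw [if_pos hcond]
      congr 1
      refine lintegral_congr_ae ?_
      filter_upwards [hae] with y h1
      rw [← h1 0, ← h1 1]
    rw [← hE] at hle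
    refine ((tendsto_energy_truncatedProfile hη hμ (hρ1 m) hg hunit).eventually
      (gt_mem_nhds (hle.trans_lt ?_))).mono fun γ h => le_of_lt h
    refine ENNReal.add_lt_add_left hfin ?_
    have hpos : 0 < 1 / μ / ((m : ℝ) + 2) := by positivity
    rw [ENNReal.ofReal_lt_ofReal_iff (by positivity)]
    simp only [hρ]
    linarith
  -- Any natural-valued function diverging as `γ → 1⁺` serves as the cap in the diagonal argument.
  have hb : Tendsto (fun γ : ℝ => ⌊(γ - 1)⁻¹⌋₊) (𝓝[>] 1) atTop := by
    refine tendsto_nat_floor_atTop.comp (tendsto_inv_nhdsGT_zero.comp ?_)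
    refine tendsto_nhdsWithin_iff.2 ⟨?_, ?_⟩
    · have : Tendsto (fun γ : ℝ => γ - 1) (𝓝 1) (𝓝 (1 - 1)) := tendsto_id.sub_const 1
      rw [sub_self] at this
      exact this.mono_left nhdsWithin_le_nhds
    · filter_upwards [self_mem_nhdsWithin] with γ hγ
      exact sub_pos.2 (Set.mem_Ioi.1 hγ)
  obtain ⟨N, hN, hNe⟩ := exists_diagonal hb hev
  refine ⟨fun γ => truncatedProfile a g (ρ (N γ)), fun γ _ i =>
    ⟨_, hasWeakDerivOn_truncatedProfile (hρ1 _) hg i⟩, ?_, ?_⟩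
  · intro K hK hKU
    obtain ⟨α, β, hαβ, hK', hI⟩ := exists_Icc_of_isCompact hU hU' (K := insert 0 K)
      (hK.insert 0) ⟨0, by simp⟩ (Set.insert_subset h0 hKU)
    have hα : -(1 / μ) < α := (hI ⟨le_rfl, hαβ.le⟩).1
    have hβ : β < 1 / μ := (hI ⟨hαβ.le, le_rfl⟩).2
    have h1 : ∀ᶠ γ in 𝓝[>] (1 : ℝ), max (-α) β < ρ (N γ) :=
      (hρlim.comp hN).eventually (lt_mem_nhds (max_lt (by linarith) hβ))
    -- Once `[-ρ, ρ]` contains `K`, the truncation equals `Θ` almost everywhere on `K`, so the norm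
    -- is exactly zero.
    refine tendsto_const_nhds.congr' ?_
    filter_upwards [h1] with γ hγ
    have hz : (fun y => truncatedProfile a g (ρ (N γ)) y - Θ y) =ᵐ[volume.restrict K] 0 := by
      filter_upwards [ae_restrict_of_subset hKU hae, ae_restrict_mem hK.measurableSet]
        with y hy hyK
      have hym := hK' (Set.mem_insert_of_mem 0 hyK)
      have hyr : y ∈ Set.Icc (-ρ (N γ)) (ρ (N γ)) :=
        ⟨by linarith [hym.1, le_max_left (-α) β], by linarith [hym.2, le_max_right (-α) β]⟩
      refine sub_eq_zero.2 ?_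
      ext i
      rw [truncatedProfile_apply_of_mem (hρ0 _) hyr, hy i]
    rw [eLpNorm_congr_ae hz, eLpNorm_zero]
  · have hT : Tendsto (fun γ => limitEnergy μ Θ
        + ENNReal.ofReal (2 * (1 / μ / ((N γ : ℝ) + 2)))) (𝓝[>] 1) (𝓝 (limitEnergy μ Θ)) := by
      have h2 := ENNReal.tendsto_ofReal ((he.comp hN).const_mul 2)
      have h3 := (tendsto_const_nhds (x := limitEnergy μ Θ)).add h2
      simpa using h3
    rw [← hT.limsup_eq]
    exact limsup_le_limsup hNe

end DomainWall

theorem lemma4p1 (η : ℝ → ℝ → ℝ)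
    (hη : ∀ ε : ℝ, 0 < ε → ε < 1 → DomainWall.IsGroundState ε (η ε))
    (μ : ℝ) (hμ : 0 < μ) :
    -- (i) compactness
    (∀ (γ : ℕ → ℝ) (Θs : ℕ → DomainWall.Profile),
      Tendsto γ atTop (𝓝[>] 1) →
      (∀ n, DomainWall.MemH1Loc Set.univ (Θs n)) →
      (∃ C : ℝ≥0, ∀ᶠ n in atTop, DomainWall.energy η μ (γ n) (Θs n) ≤ C) →
      ∃ (k : ℕ → ℕ) (Θ : DomainWall.Profile), StrictMono k ∧
        DomainWall.MemH1Loc (DomainWall.cloudInterval μ) Θ ∧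
        DomainWall.TendstoWeaklyH1Loc (DomainWall.cloudInterval μ) (fun n => Θs (k n)) atTop Θ ∧
        ContinuousOn Θ (DomainWall.cloudInterval μ) ∧
        ∀ y ∈ DomainWall.cloudInterval μ, ‖Θ y‖ ^ 2 = 1) ∧
    -- (ii) the liminf inequality
    (∀ (γ : ℕ → ℝ) (Θs : ℕ → DomainWall.Profile) (Θ : DomainWall.Profile),
      Tendsto γ atTop (𝓝[>] 1) →
      (∀ n, DomainWall.MemH1Loc Set.univ (Θs n)) →
      DomainWall.MemL2Loc (DomainWall.cloudInterval μ) Θ →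
      DomainWall.TendstoL2Loc (DomainWall.cloudInterval μ) Θs atTop Θ →
      DomainWall.limitEnergy μ Θ ≤
        liminf (fun n => DomainWall.energy η μ (γ n) (Θs n)) atTop) ∧
    -- (iii) the limsup inequality
    (∀ Θ : DomainWall.Profile, DomainWall.MemH1Loc (DomainWall.cloudInterval μ) Θ →
      ∃ Θs : ℝ → DomainWall.Profile,
        (∀ γ, 1 < γ → DomainWall.MemH1Loc Set.univ (Θs γ)) ∧
        DomainWall.TendstoL2Loc (DomainWall.cloudInterval μ) Θs (𝓝[>] 1) Θ ∧
        limsup (fun γ => DomainWall.energy η μ γ (Θs γ)) (𝓝[>] 1) ≤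
          DomainWall.limitEnergy μ Θ) := by
  refine ⟨?_, ?_, ?_⟩
  · rintro γ Θs hγ hΘ ⟨C, hC⟩
    obtain ⟨k, Θ, h1, h2, h3, h4, h5, -, -⟩ := DomainWall.exists_weak_limit hη hμ hγ hΘ hC
    exact ⟨k, Θ, h1, h2, h3, h4, h5⟩
  · intro γ Θs Θ hγ hΘs hΘ hlim
    exact DomainWall.limitEnergy_le_liminf hη hμ hγ hΘs hΘ hlim
  · intro Θ hΘ
    exact DomainWall.exists_recovery hη hμ hΘ
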